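/- All orderings are countable (possibly empty) and are counted up to isomorphism. A structure is homogeneous if every isomorphism between finitely generated substructures extends to an automorphism. In a linear ordering, the successors of a point $x$ are the points reached from $x$ by passing one or more times to an immediate successor; predecessors are defined dually. Let $S_i(x)$ say that $x$ has exactly $i$ successors, $P_j(x)$ that $x$ has exactly $j$ predecessors, and $\mathrm{Adj}_l(x,y)$ that $x\ne y$ and exactly $l$ points lie strictly between $x$ and $y$. For $n,m\in\mathbb N$, a linear ordering is $C_{n,m}$-homogeneous if its expansion by $\{S_i\}_{i<n}$, $\{P_j\}_{j<m}$, $\{\mathrm{Adj}_l\}_{l<n+m}$ is homogeneous. It is sp-homogeneous if its expansion by the functions $s,p$ is homogeneous, where $s(x)$ (resp. $p(x)$) is the immediate successor (resp. predecessor) of $x$ if it exists and $x$ otherwise. The block of $x$ is the set of points $y$ such that only finitely many points lie between $x$ and $y$. Let $I_{n,m}$ be the number of $C_{n,m}$-homogeneous linear orderings, $I(k)$ the number of sp-homogeneous linear orderings all of whose blocks have at most $k$ elements, and $L(k)$ the number of homogeneous linear orderings with $k$ colors (linear orderings in which each point carries exactly one of $k$ given colors, the colors being unary predicates of the language; not all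 colors need to be used). Proposition. All these numbers are finite. There is an absolute constant $C$ such that for all $n,m\ge 0$, with $k=n+m+1$, $$I_{n,m}\le C\,k!\,(2.123)^k ,$$ and $I_{n,m}/L(k)\to 0$ as $k=n+m+1\to\infty$, uniformly in the choice of $n,m$. Likewise $I(k)=O(k!\,(2.123)^k)$ and $\lim_{k\to\infty} I(k)/L(k)=0$. -/

import Mathlib

open Filter Topology
open scoped Nat

namespace LinHom

open FirstOrder

noncomputable section

section Predicates

variable {X : Type} [LinearOrder X]

/-- The iterated immediate successors of `x`: the points obtained from `x` by passing to
an immediate successor one or more times. -/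
def succs (x : X) : Set X := {y | Relation.TransGen (· ⋖ ·) x y}

/-- The iterated immediate predecessors of `x`. -/
def preds (x : X) : Set X := {y | Relation.TransGen (· ⋖ ·) y x}

/-- `S_i`: the point `x` has exactly `i` successors. -/
def HasSuccs (i : ℕ) (x : X) : Prop := (succs x).encard = i

/-- `P_j`: the point `x` has exactly `j` predecessors. -/
def HasPreds (j : ℕ) (x : X) : Prop := (preds x).encard = j

/-- `Adj_l`: there are exactly `l` points strictly between the distinct points `x` and `y`. -/
def Adj (l : ℕ) (x y : X) : Prop := x ≠ y ∧ (Set.Ioo (min x y) (max x y)).encard = l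

/-- The block of `x`: all points that are finitely far from `x`. -/
def block (x : X) : Set X := {y | (Set.uIcc x y).Finite}

open Classical in
/-- The immediate successor of `x` if there is one, and `x` otherwise. -/
def succFn (x : X) : X := if h : ∃ y, x ⋖ y then h.choose else x

open Classical in
/-- The immediate predecessor of `x` if there is one, and `x` otherwise. -/
def predFn (x : X) : X := if h : ∃ y, y ⋖ x then h.choose else x

end Predicates

/-- The relation symbols `<`, `S_i` (`i < n`), `P_j` (`j < m`), `Adj_l` (`l < n + m`). -/
inductive CRel (n m : ℕ) : ℕ → Type
  | lt : CRel n m 2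
  | S (i : Fin n) : CRel n m 1
  | P (j : Fin m) : CRel n m 1
  | Adj (l : Fin (n + m)) : CRel n m 2

/-- The relational language of `C_{n,m}`. -/
def CLang (n m : ℕ) : Language := ⟨fun _ => Empty, CRel n m⟩

/-- The expansion by definitions of a linear ordering to the language of `C_{n,m}`. -/
abbrev CStructure (n m : ℕ) (X : Type) [LinearOrder X] : (CLang n m).Structure X where
  funMap := fun f _ => Empty.elim f
  RelMap := fun r => match r with
    | CRel.lt => fun v => v 0 < v 1
    | CRel.S i => fun v => HasSuccs i (v 0)
    | CRel.P j => fun v => HasPreds j (v 0)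
    | CRel.Adj l => fun v => Adj l (v 0) (v 1)

/-- The function symbols `s` and `p`. -/
inductive SpFunc : ℕ → Type
  | s : SpFunc 1
  | p : SpFunc 1

/-- The relation symbol `<`. -/
inductive LtRel : ℕ → Type
  | lt : LtRel 2

/-- The language with `<` and unary functions `s`, `p`. -/
def SpLang : Language := ⟨SpFunc, LtRel⟩

/-- A linear ordering with its successor and predecessor functions. -/
abbrev SpStructure (X : Type) [LinearOrder X] : SpLang.Structure X where
  funMap := fun f => match f with
    | SpFunc.s => fun v => succFn (v 0)
    | SpFunc.p => fun v => predFn (v 0)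
  RelMap := fun r => match r with
    | LtRel.lt => fun v => v 0 < v 1

/-- `X` is `C_{n,m}`-homogeneous: in the language of `C_{n,m}`, every isomorphism between finitely
generated (here: finite) substructures extends to an automorphism. -/
def CHomogeneous (n m : ℕ) (X : Type) [LinearOrder X] : Prop :=
  @Language.IsUltrahomogeneous (CLang n m) X (CStructure n m X)

/-- `X` is sp-homogeneous: `(X, <, s, p)` is homogeneous. -/
def SpHomogeneous (X : Type) [LinearOrder X] : Prop :=
  @Language.IsUltrahomogeneous SpLang X (SpStructure X)

/-- Isomorphism of linear orderings. -/
instance linOrdSetoid : Setoid LinOrd.{0} where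
  r X Y := Nonempty (X ≃o Y)
  iseqv := ⟨fun _ => ⟨OrderIso.refl _⟩, fun ⟨e⟩ => ⟨e.symm⟩, fun ⟨e⟩ ⟨f⟩ => ⟨e.trans f⟩⟩

/-- The order types of the countable `C_{n,m}`-homogeneous linear orderings. -/
def cHomTypes (n m : ℕ) : Set (Quotient linOrdSetoid) :=
  Quotient.mk linOrdSetoid '' {X | Countable X ∧ CHomogeneous n m X}

/-- The order types of the countable sp-homogeneous linear orderings all of whose blocks have
at most `k` elements. -/
def spHomTypes (k : ℕ) : Set (Quotient linOrdSetoid) :=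
  Quotient.mk linOrdSetoid '' {X | Countable X ∧ SpHomogeneous X ∧ ∀ x : X, (block x).encard ≤ k}

/-- A countable linear ordering each of whose points carries one of `k` colors. -/
structure ColoredLinOrd (k : ℕ) where
  carrier : Type
  [order : LinearOrder carrier]
  [countable : Countable carrier]
  color : carrier → Fin k

attribute [instance] ColoredLinOrd.order

/-- The relation symbol `<` and a unary predicate for each of the `k` colors. -/
inductive ColorRel (k : ℕ) : ℕ → Type
  | lt : ColorRel k 2
  | color (i : Fin k) : ColorRel k 1

/-- The language of `k`-colored linear orderings. -/
def ColorLang (k : ℕ) : Language := ⟨fun _ => Empty, ColorRel k⟩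

instance colorStructure {k : ℕ} (X : ColoredLinOrd k) : (ColorLang k).Structure X.carrier where
  funMap := fun f _ => Empty.elim f
  RelMap := fun r => match r with
    | ColorRel.lt => fun v => v 0 < v 1
    | ColorRel.color i => fun v => X.color (v 0) = i

/-- Isomorphism of `k`-colored linear orderings: an order isomorphism that preserves colors. -/
instance coloredSetoid (k : ℕ) : Setoid (ColoredLinOrd k) where
  r X Y := ∃ e : X.carrier ≃o Y.carrier, ∀ x, Y.color (e x) = X.color x
  iseqv := ⟨fun _ => ⟨OrderIso.refl _, fun _ => rfl⟩,
    fun ⟨e, he⟩ => ⟨e.symm, fun x => by rw [← he, e.apply_symm_apply]⟩,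
    fun ⟨e, he⟩ ⟨f, hf⟩ => ⟨e.trans f, fun x => (hf (e x)).trans (he x)⟩⟩

/-- The isomorphism types of the countable homogeneous linear orderings with `k` colors. -/
def colorHomTypes (k : ℕ) : Set (Quotient (coloredSetoid k)) :=
  Quotient.mk (coloredSetoid k) '' {X | (ColorLang k).IsUltrahomogeneous X.carrier}

/-- The number of `C_{n,m}`-homogeneous linear orderings. -/
def numC (n m : ℕ) : ℕ := (cHomTypes n m).ncard

/-- The number of sp-homogeneous linear orderings with blocks of size at most `k`. -/
def numSp (k : ℕ) : ℕ := (spHomTypes k).ncard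

/-- `L(k)`: the number of homogeneous linear orderings with `k` colors. -/
def numColored (k : ℕ) : ℕ := (colorHomTypes k).ncard

end

end LinHom

/-! A countable colored ordering is homogeneous exactly when it is saturated: a point of a given
color occurs wherever the relation R, "some point of color c precedes some point of color d",
permits one. By back and forth (`IsSaturated.exists_orderIso`) it is determined by the set U of used
colors together with R. On U the relation R is transitive and compares any two distinct colors, so
it is a finite chain of classes: a class is either one irreflexive color (a single point) or a
nonempty set of reflexive colors (a dense shuffle).

Every such arrangement of all k colors is realized (`card_arrangements_le_numColored`). Let a_u be
the number of arrangements of u colors. Top classes with one color, of either kind, and with two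
reflexive colors give a_u ≥ 2u a_{u-1} + C(u,2) a_{u-2}. Hence L(k) ≥ (10/11) k! (11/5)^k
(`le_card_arrangements`, `le_numColored`).

An ordering with finite blocks is recovered from the first points of its blocks, colored by block
size. If the ordering is sp-homogeneous, this colored ordering is saturated. Between two different
blocks lies a third, so R is interpolative and two irreflexive classes are never adjacent. This
lowers the growth rate: I(k) ≤ (5/2) k! 2^k (`spHomTypes_finite_and_numSp_le`). Since 2 < 2.123 and
2 < 11/5, both claims about I(k) follow.

Finally, a C_{n,m}-homogeneous ordering has blocks of at most n+m+1 points
(`CHomogeneous.encard_block_le`) and is sp-homogeneous (`CHomogeneous.spHomogeneous`), so its type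
is already counted by I(n+m+1). -/

namespace LinHom

/-! ### Saturated colored orderings and back and forth -/

section BackAndForth

variable {X Y κ : Type*} [LinearOrder X] [LinearOrder Y]

/-- A finite set of pairs is a partial isomorphism of colored linear orderings. -/
def IsPartialIso (cX : X → κ) (cY : Y → κ) (F : Finset (X × Y)) : Prop :=
  (∀ p ∈ F, cY p.2 = cX p.1) ∧ ∀ p ∈ F, ∀ q ∈ F, p.1 < q.1 ↔ p.2 < q.2

/-- The color `c` occurs somewhere before the color `d`. -/
def ColorBefore (cX : X → κ) (c d : κ) : Prop := ∃ x y, x < y ∧ cX x = c ∧ cX y = d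

/-- Every colored point whose existence is compatible with `ColorBefore` exists. -/
structure IsSaturated (cX : X → κ) : Prop where
  between : ∀ x y c, x < y → ColorBefore cX (cX x) c → ColorBefore cX c (cX y) →
    ∃ z, x < z ∧ z < y ∧ cX z = c
  above : ∀ x c, ColorBefore cX (cX x) c → ∃ z, x < z ∧ cX z = c
  below : ∀ x c, ColorBefore cX c (cX x) → ∃ z, z < x ∧ cX z = c

theorem IsPartialIso.eq_iff {cX : X → κ} {cY : Y → κ} {F : Finset (X × Y)}
    (h : IsPartialIso cX cY F) {p q : X × Y} (hp : p ∈ F) (hq : q ∈ F) :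
    p.1 = q.1 ↔ p.2 = q.2 := by
  have h1 := h.2 p hp q hq
  have h2 := h.2 q hq p hp
  constructor
  · intro e
    rw [e] at h1 h2
    exact le_antisymm (not_lt.1 fun hh => lt_irrefl _ (h2.2 hh))
      (not_lt.1 fun hh => lt_irrefl _ (h1.2 hh))
  · intro e
    rw [e] at h1 h2
    exact le_antisymm (not_lt.1 fun hh => lt_irrefl _ (h2.1 hh))
      (not_lt.1 fun hh => lt_irrefl _ (h1.1 hh))

theorem IsPartialIso.swap {cX : X → κ} {cY : Y → κ} {F : Finset (X × Y)}
    (h : IsPartialIso cX cY F) :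
    IsPartialIso cY cX (F.map (Equiv.prodComm X Y).toEmbedding) := by
  constructor
  · intro p hp
    obtain ⟨q, hq, rfl⟩ := Finset.mem_map.1 hp
    exact (h.1 q hq).symm
  · intro p hp p' hp'
    obtain ⟨q, hq, rfl⟩ := Finset.mem_map.1 hp
    obtain ⟨q', hq', rfl⟩ := Finset.mem_map.1 hp'
    exact (h.2 q hq q' hq').symm

/-- Only the nearest pairs of `F` on either side of `x` constrain `y`. Their colors stand in the
relation `ColorBefore` to the color of `x`, by `hR` also in `Y`, so one clause of saturation applies
according to which neighbors exist. -/
theorem IsSaturated.exists_compatible {cX : X → κ} {cY : Y → κ} (hY : IsSaturated cY)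
    (hU : ∀ x, ∃ y, cY y = cX x)
    (hR : ∀ c d, ColorBefore cX c d → ColorBefore cY c d) {F : Finset (X × Y)}
    (hF : IsPartialIso cX cY F) (x : X) :
    ∃ y, cY y = cX x ∧ (∀ p ∈ F, p.1 < x → p.2 < y) ∧ (∀ p ∈ F, x < p.1 → y < p.2) := by
  classical
  have hlo : (∀ p ∈ F, ¬ p.1 < x) ∨ ∃ a ∈ F, a.1 < x ∧ ∀ p ∈ F, p.1 < x → p.2 ≤ a.2 := by
    rcases (F.filter (fun p => p.1 < x)).eq_empty_or_nonempty with h | h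
    · exact Or.inl fun p hp hpx => by
        have : p ∈ F.filter (fun p => p.1 < x) := Finset.mem_filter.2 ⟨hp, hpx⟩
        simp [h] at this
    · obtain ⟨a, ha, hmax⟩ := Finset.exists_max_image _ Prod.snd h
      rw [Finset.mem_filter] at ha
      exact Or.inr ⟨a, ha.1, ha.2, fun p hp hpx => hmax p (Finset.mem_filter.2 ⟨hp, hpx⟩)⟩
  have hhi : (∀ p ∈ F, ¬ x < p.1) ∨ ∃ b ∈ F, x < b.1 ∧ ∀ p ∈ F, x < p.1 → b.2 ≤ p.2 := by
    rcases (F.filter (fun p => x < p.1)).eq_empty_or_nonempty with h | h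
    · exact Or.inl fun p hp hpx => by
        have : p ∈ F.filter (fun p => x < p.1) := Finset.mem_filter.2 ⟨hp, hpx⟩
        simp [h] at this
    · obtain ⟨a, ha, hmin⟩ := Finset.exists_min_image _ Prod.snd h
      rw [Finset.mem_filter] at ha
      exact Or.inr ⟨a, ha.1, ha.2, fun p hp hpx => hmin p (Finset.mem_filter.2 ⟨hp, hpx⟩)⟩
  have before : ∀ a ∈ F, a.1 < x → ColorBefore cY (cY a.2) (cX x) := fun a ha hax =>
    hR _ _ ⟨a.1, x, hax, (hF.1 a ha).symm, rfl⟩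
  have after : ∀ a ∈ F, x < a.1 → ColorBefore cY (cX x) (cY a.2) := fun a ha hax =>
    hR _ _ ⟨x, a.1, hax, rfl, (hF.1 a ha).symm⟩
  rcases hlo with hlo | ⟨a, ha, hax, hamax⟩ <;> rcases hhi with hhi | ⟨b, hb, hbx, hbmin⟩
  · obtain ⟨y, hy⟩ := hU x
    exact ⟨y, hy, fun p hp h => (hlo p hp h).elim, fun p hp h => (hhi p hp h).elim⟩
  · obtain ⟨y, hy, hc⟩ := hY.below _ _ (after b hb hbx)
    exact ⟨y, hc, fun p hp h => (hlo p hp h).elim, fun p hp h => hy.trans_le (hbmin p hp h)⟩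
  · obtain ⟨y, hy, hc⟩ := hY.above _ _ (before a ha hax)
    exact ⟨y, hc, fun p hp h => (hamax p hp h).trans_lt hy, fun p hp h => (hhi p hp h).elim⟩
  · obtain ⟨y, hy, hy', hc⟩ := hY.between a.2 b.2 (cX x) ((hF.2 a ha b hb).1 (hax.trans hbx))
      (before a ha hax) (after b hb hbx)
    exact ⟨y, hc, fun p hp h => (hamax p hp h).trans_lt hy,
      fun p hp h => hy'.trans_le (hbmin p hp h)⟩

theorem IsSaturated.exists_extension {cX : X → κ} {cY : Y → κ} (hY : IsSaturated cY)
    (hU : ∀ x, ∃ y, cY y = cX x)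
    (hR : ∀ c d, ColorBefore cX c d → ColorBefore cY c d) {F : Finset (X × Y)}
    (hF : IsPartialIso cX cY F) (x : X) :
    ∃ G, IsPartialIso cX cY G ∧ F ⊆ G ∧ ∃ y, (x, y) ∈ G := by
  classical
  by_cases hx : ∃ y, (x, y) ∈ F
  · exact ⟨F, hF, subset_rfl, hx⟩
  obtain ⟨y, hc, hlo, hhi⟩ := hY.exists_compatible hU hR hF x
  have hne : ∀ p ∈ F, p.1 ≠ x := fun p hp e => hx ⟨p.2, by rw [← e]; exact hp⟩
  have hlt : ∀ p ∈ F, (p.1 < x ↔ p.2 < y) := fun p hp => ⟨hlo p hp, fun h =>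
    (lt_or_gt_of_ne (hne p hp)).resolve_right fun h' => lt_asymm h (hhi p hp h')⟩
  have hgt : ∀ p ∈ F, (x < p.1 ↔ y < p.2) := fun p hp => ⟨hhi p hp, fun h =>
    (lt_or_gt_of_ne (hne p hp)).resolve_left fun h' => lt_asymm h (hlo p hp h')⟩
  refine ⟨insert (x, y) F, ⟨?_, ?_⟩, Finset.subset_insert _ _, y, Finset.mem_insert_self _ _⟩
  · intro p hp
    rcases Finset.mem_insert.1 hp with rfl | hp
    exacts [hc, hF.1 p hp]
  · intro p hp q hq
    rcases Finset.mem_insert.1 hp with rfl | hp <;> rcases Finset.mem_insert.1 hq with rfl | hq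
    · simp
    · exact hgt q hq
    · exact hlt p hp
    · exact hF.2 p hp q hq

/-- Back and forth between countable saturated colored linear orderings. -/
theorem IsSaturated.exists_orderIso [Countable X] [Countable Y] {cX : X → κ} {cY : Y → κ}
    (hX : IsSaturated cX) (hY : IsSaturated cY)
    (hU : ∀ c, (∃ x, cX x = c) ↔ ∃ y, cY y = c)
    (hR : ∀ c d, ColorBefore cX c d ↔ ColorBefore cY c d) {F : Finset (X × Y)}
    (hF : IsPartialIso cX cY F) :
    ∃ e : X ≃o Y, (∀ x, cY (e x) = cX x) ∧ ∀ p ∈ F, e p.1 = p.2 := by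
  classical
  let P := {G : Finset (X × Y) // IsPartialIso cX cY G}
  let _ := Encodable.ofCountable X
  let _ := Encodable.ofCountable Y
  -- An ideal of partial isomorphisms that meets all these cofinal sets is total and surjective.
  -- Countability makes the index type encodable, as the construction of the ideal requires.
  let D : X ⊕ Y → Order.Cofinal P := Sum.elim
    (fun x => ⟨{G | ∃ y, (x, y) ∈ G.1}, fun G => by
      obtain ⟨G', h, h1, h2⟩ := hY.exists_extension (fun x => (hU _).1 ⟨x, rfl⟩)
        (fun c d => (hR c d).1) G.2 x
      exact ⟨⟨G', h⟩, h2, h1⟩⟩)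
    (fun y => ⟨{G | ∃ x, (x, y) ∈ G.1}, fun G => by
      obtain ⟨G', h, h1, x, hx⟩ := hX.exists_extension (fun y => (hU _).2 ⟨y, rfl⟩)
        (fun c d => (hR c d).2) G.2.swap y
      refine ⟨⟨_, h.swap⟩, ⟨x, ?_⟩, ?_⟩
      · exact Finset.mem_map.2 ⟨_, hx, rfl⟩
      · intro p hp
        exact Finset.mem_map.2 ⟨(p.2, p.1), h1 (Finset.mem_map.2 ⟨p, hp, rfl⟩), rfl⟩⟩)
  let I := Order.idealOfCofinals (⟨F, hF⟩ : P) D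
  have hdir : ∀ p q : X × Y, (∃ G ∈ I, p ∈ G.1) → (∃ G ∈ I, q ∈ G.1) →
      ∃ G : P, p ∈ G.1 ∧ q ∈ G.1 := by
    rintro p q ⟨G, hG, hp⟩ ⟨G', hG', hq⟩
    obtain ⟨H, -, h1, h2⟩ := I.directed _ hG _ hG'
    exact ⟨H, h1 hp, h2 hq⟩
  have hl : ∀ x, ∃ y, ∃ G ∈ I, (x, y) ∈ G.1 := fun x => by
    obtain ⟨G, ⟨y, hy⟩, hG⟩ := Order.cofinal_meets_idealOfCofinals (⟨F, hF⟩ : P) D (Sum.inl x)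
    exact ⟨y, G, hG, hy⟩
  have hr : ∀ y, ∃ x, ∃ G ∈ I, (x, y) ∈ G.1 := fun y => by
    obtain ⟨G, ⟨x, hx⟩, hG⟩ := Order.cofinal_meets_idealOfCofinals (⟨F, hF⟩ : P) D (Sum.inr y)
    exact ⟨x, G, hG, hx⟩
  choose f hf using hl
  choose g hg using hr
  have hmono : StrictMono f := fun x x' h => by
    obtain ⟨G, h1, h2⟩ := hdir _ _ (hf x) (hf x')
    exact (G.2.2 _ h1 _ h2).1 h
  have hfg : ∀ y, f (g y) = y := fun y => by
    obtain ⟨G, h1, h2⟩ := hdir _ _ (hf (g y)) (hg y)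
    exact (G.2.eq_iff h1 h2).1 rfl
  refine ⟨hmono.orderIsoOfSurjective f fun y => ⟨g y, hfg y⟩, fun x => ?_, fun p hp => ?_⟩
  · obtain ⟨G, -, hG⟩ := hf x
    exact G.2.1 _ hG
  · obtain ⟨G, h1, h2⟩ := hdir _ _ (hf p.1) ⟨_, Order.mem_idealOfCofinals (⟨F, hF⟩ : P) D, hp⟩
    exact (G.2.eq_iff h1 h2).1 rfl

/-- Homogeneity for finite partial isomorphisms implies saturation. -/
theorem IsSaturated.of_homogeneous {cX : X → κ}
    (h : ∀ F : Finset (X × X), IsPartialIso cX cX F →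
      ∃ g : X → X, StrictMono g ∧ (∀ x, cX (g x) = cX x) ∧ ∀ p ∈ F, g p.1 = p.2) :
    IsSaturated cX := by
  classical
  have above : ∀ x c, ColorBefore cX (cX x) c → ∃ z, x < z ∧ cX z = c := by
    rintro x c ⟨x', z', hlt, hx, rfl⟩
    obtain ⟨g, hg, hc, hF⟩ := h {(x', x)} (by simp [IsPartialIso, hx])
    have : g x' = x := hF _ (Finset.mem_singleton_self _)
    exact ⟨g z', this ▸ hg hlt, hc _⟩
  have below : ∀ x c, ColorBefore cX c (cX x) → ∃ z, z < x ∧ cX z = c := by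
    rintro x c ⟨z', x', hlt, rfl, hx⟩
    obtain ⟨g, hg, hc, hF⟩ := h {(x', x)} (by simp [IsPartialIso, hx])
    have : g x' = x := hF _ (Finset.mem_singleton_self _)
    exact ⟨g z', this ▸ hg hlt, hc _⟩
  refine ⟨?_, above, below⟩
  intro x y c hxy hxc hcy
  -- The point `z` may lie beyond `y`. A point `y'` of the color of `y` is found above `z`, and a
  -- map fixing `x` and sending `y'` to `y` carries `z` into the interval.
  obtain ⟨z, hxz, rfl⟩ := above x c hxc
  obtain ⟨y', hzy, hy'⟩ := above z _ hcy
  obtain ⟨g, hg, hc, hF⟩ := h {(x, x), (y', y)} (by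
    have := hxz.trans hzy
    constructor
    · simp [hy']
    · simp [hxy, this, this.not_gt, hxy.not_gt])
  have h1 : g x = x := hF (x, x) (by simp)
  have h2 : g y' = y := hF (y', y) (by simp)
  exact ⟨g z, by simpa [h1] using hg hxz, by simpa [h2] using hg hzy, hc _⟩

end BackAndForth

/-! ### Upper bound for interpolative arrangements -/

section Counting

variable {α : Type*}

/-- Transitive relations on `U` which compare any two distinct elements. -/
structure IsArrangement (U : Finset α) (R : Finset (α × α)) : Prop where
  left_mem : ∀ a b, (a, b) ∈ R → a ∈ U
  right_mem : ∀ a b, (a, b) ∈ R → b ∈ U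
  trans : ∀ a b c, (a, b) ∈ R → (b, c) ∈ R → (a, c) ∈ R
  total : ∀ a ∈ U, ∀ b ∈ U, a ≠ b → (a, b) ∈ R ∨ (b, a) ∈ R

/-- Related elements have an element between them. -/
def Interpolative (R : Finset (α × α)) : Prop :=
  ∀ a b, (a, b) ∈ R → ∃ e, (a, e) ∈ R ∧ (e, b) ∈ R

/-- `a` lies above all other elements of `U`. -/
def IsTop (U : Finset α) (R : Finset (α × α)) (a : α) : Prop :=
  a ∈ U ∧ ∀ b ∈ U, b ≠ a → (b, a) ∈ R

open Classical in
/-- The arrangements of `U`. -/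
noncomputable def arrangements (U : Finset α) : Finset (Finset (α × α)) :=
  (U ×ˢ U).powerset.filter (IsArrangement U)

open Classical in
/-- The interpolative arrangements of `U`. -/
noncomputable def denseArrangements (U : Finset α) : Finset (Finset (α × α)) :=
  (arrangements U).filter Interpolative

open Classical in
/-- The interpolative arrangements of `U` whose top elements are reflexive. -/
noncomputable def topDenseArrangements (U : Finset α) : Finset (Finset (α × α)) :=
  (denseArrangements U).filter fun R => ∀ a, IsTop U R a → (a, a) ∈ R

theorem mem_arrangements {U : Finset α} {R : Finset (α × α)} :
    R ∈ arrangements U ↔ IsArrangement U R := by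
  simp only [arrangements, Finset.mem_filter, Finset.mem_powerset, and_iff_right_iff_imp]
  rintro h ⟨a, b⟩ hab
  exact Finset.mem_product.2 ⟨h.left_mem _ _ hab, h.right_mem _ _ hab⟩

theorem mem_denseArrangements {U : Finset α} {R : Finset (α × α)} :
    R ∈ denseArrangements U ↔ IsArrangement U R ∧ Interpolative R := by
  simp [denseArrangements, mem_arrangements]

theorem mem_topDenseArrangements {U : Finset α} {R : Finset (α × α)} :
    R ∈ topDenseArrangements U ↔
      (IsArrangement U R ∧ Interpolative R) ∧ ∀ a, IsTop U R a → (a, a) ∈ R := by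
  simp [topDenseArrangements, mem_denseArrangements]

theorem sum_powerset_card (U : Finset α) (f : ℕ → ℝ) :
    ∑ S ∈ U.powerset, f S.card = ∑ j ∈ Finset.range (U.card + 1), (U.card.choose j : ℝ) * f j := by
  rw [Finset.sum_powerset_apply_card]
  simp

open Classical in
/-- The top class of an arrangement. -/
noncomputable def topClass (U : Finset α) (R : Finset (α × α)) : Finset α :=
  U.filter (IsTop U R)

theorem mem_topClass {U : Finset α} {R : Finset (α × α)} {a : α} :
    a ∈ topClass U R ↔ IsTop U R a := by
  simp only [topClass, Finset.mem_filter, and_iff_right_iff_imp]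
  exact fun h => h.1

theorem topClass_subset (U : Finset α) (R : Finset (α × α)) : topClass U R ⊆ U :=
  fun _ h => (mem_topClass.1 h).1

variable [DecidableEq α]

/-- Adding a new top class `S`. -/
def extend (U S : Finset α) (b : Bool) (R : Finset (α × α)) : Finset (α × α) :=
  R ∪ (U \ S) ×ˢ S ∪ if b then S ×ˢ S else ∅

theorem mem_extend {U S : Finset α} {b : Bool} {R : Finset (α × α)} {x y : α} :
    (x, y) ∈ extend U S b R ↔
      (x, y) ∈ R ∨ ((x ∈ U ∧ x ∉ S) ∧ y ∈ S) ∨ (b = true ∧ x ∈ S ∧ y ∈ S) := by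
  cases b <;> simp [extend, Finset.mem_sdiff]

/-- The restriction of a relation to a finset. -/
def restrict (V : Finset α) (R : Finset (α × α)) : Finset (α × α) :=
  R.filter fun p => p.1 ∈ V ∧ p.2 ∈ V

theorem mem_restrict {V : Finset α} {R : Finset (α × α)} {x y : α} :
    (x, y) ∈ restrict V R ↔ (x, y) ∈ R ∧ x ∈ V ∧ y ∈ V := by
  simp [restrict]

theorem IsArrangement.restrict {U V : Finset α} {R : Finset (α × α)} (h : IsArrangement U R)
    (hV : V ⊆ U) : IsArrangement V (restrict V R) where
  left_mem a b hab := (mem_restrict.1 hab).2.1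
  right_mem a b hab := (mem_restrict.1 hab).2.2
  trans a b c hab hbc := by
    rw [mem_restrict] at *
    exact ⟨h.trans _ _ _ hab.1 hbc.1, hab.2.1, hbc.2.2⟩
  total a ha b hb hne := by
    simp only [mem_restrict, ha, hb, and_self, and_true]
    exact h.total a (hV ha) b (hV hb) hne

theorem IsArrangement.exists_isTop {U : Finset α} {R : Finset (α × α)} (h : IsArrangement U R)
    (hU : U.Nonempty) : ∃ a, IsTop U R a := by
  induction U using Finset.induction_on generalizing R with
  | empty => exact (Finset.not_nonempty_empty hU).elim
  | insert x U hx ih =>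
    rcases U.eq_empty_or_nonempty with rfl | hne
    · exact ⟨x, by simp [IsTop]⟩
    obtain ⟨a, ha, hatop⟩ := ih (h.restrict (Finset.subset_insert x U)) hne
    have hxa : x ≠ a := fun e => hx (e ▸ ha)
    have hatop' : ∀ b ∈ U, b ≠ a → (b, a) ∈ R := fun b hb hba =>
      (mem_restrict.1 (hatop b hb hba)).1
    rcases h.total x (Finset.mem_insert_self _ _) a (Finset.mem_insert_of_mem ha) hxa with hr | hr
    · refine ⟨a, Finset.mem_insert_of_mem ha, fun b hb hba => ?_⟩
      rcases Finset.mem_insert.1 hb with rfl | hb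
      exacts [hr, hatop' b hb hba]
    · refine ⟨x, Finset.mem_insert_self _ _, fun b hb hbx => ?_⟩
      have hb := (Finset.mem_insert.1 hb).resolve_left hbx
      by_cases hba : b = a
      · rwa [hba]
      · exact h.trans _ _ _ (hatop' b hb hba) hr

/-- An element below a non-top element is not top. -/
theorem IsArrangement.isTop_of_rel {U : Finset α} {R : Finset (α × α)} (h : IsArrangement U R)
    {a b : α} (ha : IsTop U R a) (hab : (a, b) ∈ R) : IsTop U R b := by
  refine ⟨h.right_mem _ _ hab, fun c hc hcb => ?_⟩
  by_cases hca : c = a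
  · rwa [hca]
  · exact h.trans _ _ _ (ha.2 c hc hca) hab

/-- The top class is closed upwards, so an element interpolated below a non-top element is itself
not top and survives the restriction. -/
theorem IsArrangement.interpolative_restrict {U : Finset α} {R : Finset (α × α)}
    (h : IsArrangement U R) (hi : Interpolative R) :
    Interpolative (LinHom.restrict (U \ topClass U R) R) := by
  intro a b hab
  rw [mem_restrict] at hab
  obtain ⟨e, h1, h2⟩ := hi a b hab.1
  refine ⟨e, ?_⟩
  have he : e ∈ U \ topClass U R := by
    refine Finset.mem_sdiff.2 ⟨h.right_mem _ _ h1, fun he => ?_⟩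
    exact (Finset.mem_sdiff.1 hab.2.2).2 (mem_topClass.2 (h.isTop_of_rel (mem_topClass.1 he) h2))
  simp [mem_restrict, h1, h2, he, hab.2.1, hab.2.2]

/-- An arrangement is determined by its top class, the flag `b` telling whether that class is
reflexive, and what lies below. This is the decomposition behind all the recurrences. -/
theorem IsArrangement.extend_restrict {U : Finset α} {R : Finset (α × α)}
    (h : IsArrangement U R) {b : Bool}
    (hb : ∀ x ∈ topClass U R, ∀ y ∈ topClass U R, ((x, y) ∈ R ↔ b = true)) :
    extend U (topClass U R) b (LinHom.restrict (U \ topClass U R) R) = R := by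
  ext ⟨x, y⟩
  rw [mem_extend, mem_restrict]
  constructor
  · rintro (h1 | ⟨⟨hx, hxt⟩, hy⟩ | ⟨h1, hx, hy⟩)
    · exact h1.1
    · exact (mem_topClass.1 hy).2 x hx fun e => hxt (e ▸ hy)
    · exact (hb x hx y hy).2 h1
  · intro hxy
    have hx := h.left_mem _ _ hxy
    have hy := h.right_mem _ _ hxy
    by_cases hxt : x ∈ topClass U R
    · have hyt : y ∈ topClass U R := mem_topClass.2 (h.isTop_of_rel (mem_topClass.1 hxt) hxy)
      exact Or.inr (Or.inr ⟨(hb x hxt y hyt).1 hxy, hxt, hyt⟩)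
    · by_cases hyt : y ∈ topClass U R
      · exact Or.inr (Or.inl ⟨⟨hx, hxt⟩, hyt⟩)
      · exact Or.inl ⟨hxy, Finset.mem_sdiff.2 ⟨hx, hxt⟩, Finset.mem_sdiff.2 ⟨hy, hyt⟩⟩

/-- Below a reflexive top class any interpolative arrangement may stand, so the flag is `true` and
only the top class `S` and the remainder are free. -/
theorem topDenseArrangements_subset {U : Finset α} (hU : U.Nonempty) :
    topDenseArrangements U ⊆ (U.powerset.erase ∅).biUnion fun S =>
      (denseArrangements (U \ S)).image (extend U S true) := by
  intro R hR
  obtain ⟨⟨h, hi⟩, htop⟩ := mem_topDenseArrangements.1 hR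
  obtain ⟨a, ha⟩ := h.exists_isTop hU
  rw [Finset.mem_biUnion]
  refine ⟨topClass U R, ?_, Finset.mem_image.2 ⟨_, mem_denseArrangements.2
    ⟨h.restrict Finset.sdiff_subset, h.interpolative_restrict hi⟩, h.extend_restrict ?_⟩⟩
  · rw [Finset.mem_erase, Finset.mem_powerset]
    exact ⟨Finset.ne_empty_of_mem (mem_topClass.2 ha), topClass_subset U R⟩
  · intro x hx y hy
    rw [mem_topClass] at hx hy
    simp only [iff_true]
    by_cases hxy : x = y
    · exact hxy ▸ htop x hx
    · exact hy.2 x hx.1 hxy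

/-- An irreflexive top element `c` is alone in its class, since a second member would give `(c, c) ∈
R` by transitivity. Interpolating between a top element `d` of the rest and `c` then forces `d` to
be reflexive. -/
theorem denseArrangements_subset (U : Finset α) :
    denseArrangements U ⊆ topDenseArrangements U ∪ U.biUnion fun c =>
      (topDenseArrangements (U \ {c})).image (extend U {c} false) := by
  intro R hR
  obtain ⟨h, hi⟩ := mem_denseArrangements.1 hR
  by_cases htop : ∀ a, IsTop U R a → (a, a) ∈ R
  · exact Finset.mem_union_left _ (mem_topDenseArrangements.2 ⟨⟨h, hi⟩, htop⟩)
  push Not at htop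
  obtain ⟨c, hc, hcc⟩ := htop
  have hS : topClass U R = {c} := by
    ext x
    rw [mem_topClass, Finset.mem_singleton]
    refine ⟨fun hx => ?_, fun hx => hx ▸ hc⟩
    by_contra hxc
    exact hcc (h.trans _ _ _ (hx.2 c hc.1 (Ne.symm hxc)) (hc.2 x hx.1 hxc))
  refine Finset.mem_union_right _ (Finset.mem_biUnion.2 ⟨c, hc.1, Finset.mem_image.2
    ⟨restrict (U \ {c}) R, mem_topDenseArrangements.2 ⟨⟨h.restrict Finset.sdiff_subset, ?_⟩, ?_⟩,
      ?_⟩⟩)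
  · have := h.interpolative_restrict hi
    rwa [hS] at this
  · intro d hd
    have hdU := Finset.mem_sdiff.1 hd.1
    have hdc : d ≠ c := fun e => hdU.2 (Finset.mem_singleton.2 e)
    obtain ⟨e, h1, h2⟩ := hi d c (hc.2 d hdU.1 hdc)
    have hec : e ≠ c := fun e' => hcc (e' ▸ h2)
    rw [mem_restrict]
    refine ⟨?_, hd.1, hd.1⟩
    by_cases hed : e = d
    · rwa [hed] at h1
    · have := hd.2 e (Finset.mem_sdiff.2 ⟨h.left_mem _ _ h2, by simpa using hec⟩) hed
      exact h.trans _ _ _ h1 (mem_restrict.1 this).1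
  · rw [← hS]
    refine h.extend_restrict ?_
    rw [hS]
    intro x hx y hy
    rw [Finset.mem_singleton.1 hx, Finset.mem_singleton.1 hy]
    simpa using hcc

/-- These are partial sums of the series for √e, and e < 25/9. -/
theorem sum_half_pow_div_factorial_le (u : ℕ) :
    ∑ j ∈ Finset.range u, (1 / 2 : ℝ) ^ j / j ! ≤ 5 / 3 := by
  refine (Real.sum_le_exp_of_nonneg (by norm_num) u).trans ?_
  have h1 : Real.exp (1 / 2) * Real.exp (1 / 2) = Real.exp 1 := by
    rw [← Real.exp_add]; norm_num
  have h2 := Real.exp_one_lt_d9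
  have h3 := Real.exp_pos (1 / 2)
  nlinarith

theorem sum_choose_mul_le (u : ℕ) :
    ∑ j ∈ Finset.range (u + 1), (u.choose j : ℝ) * (((u - j) ! : ℝ) * 2 ^ (u - j)) ≤
      5 / 3 * ((u ! : ℝ) * 2 ^ u) := by
  have : ∀ j ∈ Finset.range (u + 1), (u.choose j : ℝ) * (((u - j) ! : ℝ) * 2 ^ (u - j)) =
      (1 / 2 : ℝ) ^ j / j ! * ((u ! : ℝ) * 2 ^ u) := by
    intro j hj
    have hj : j ≤ u := Nat.lt_succ_iff.1 (Finset.mem_range.1 hj)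
    rw [← Nat.choose_mul_factorial_mul_factorial hj]
    conv_rhs => rw [← Nat.sub_add_cancel hj, pow_add, Nat.sub_add_cancel hj]
    have : (j ! : ℝ) ≠ 0 := by positivity
    push_cast
    field_simp
    rw [mul_assoc, ← mul_pow]
    norm_num
  rw [Finset.sum_congr rfl this, ← Finset.sum_mul]
  exact mul_le_mul_of_nonneg_right (sum_half_pow_div_factorial_le _) (by positivity)

/-- Let d_u and e_u be the two cardinalities divided by u! 2^u. The decompositions give d_u ≤
Σ_{j≥1} (1/2)^j/j! · e_{u-j} and e_u ≤ d_u + d_{u-1}/2. The bounds 1 and 3/2 reproduce themselves,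
because 3/2 · (5/3 - 1) = 1 and 1 + 1/2 = 3/2. -/
theorem card_denseArrangements_le (U : Finset α) :
    ((topDenseArrangements U).card : ℝ) ≤ (U.card ! : ℝ) * 2 ^ U.card ∧
      ((denseArrangements U).card : ℝ) ≤ 3 / 2 * ((U.card ! : ℝ) * 2 ^ U.card) := by
  induction U using Finset.strongInduction with
  | H U ih =>
  have hD : ((topDenseArrangements U).card : ℝ) ≤ (U.card ! : ℝ) * 2 ^ U.card := by
    rcases U.eq_empty_or_nonempty with rfl | hU
    · have : topDenseArrangements (∅ : Finset α) ⊆ {∅} := by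
        intro R hR
        have h := (mem_topDenseArrangements.1 hR).1.1
        rw [Finset.mem_singleton]
        refine Finset.eq_empty_of_forall_notMem ?_
        rintro ⟨a, b⟩ hab
        simpa using h.left_mem _ _ hab
      have := Finset.card_le_card this
      simpa using this
    have h1 : ((topDenseArrangements U).card : ℝ) ≤
        ∑ S ∈ U.powerset.erase ∅, ((denseArrangements (U \ S)).card : ℝ) := by
      have := (Finset.card_le_card (topDenseArrangements_subset hU)).trans
        (Finset.card_biUnion_le.trans (Finset.sum_le_sum fun S _ => Finset.card_image_le))
      exact_mod_cast this
    have h2 : ∑ S ∈ U.powerset.erase ∅, ((denseArrangements (U \ S)).card : ℝ) ≤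
        ∑ S ∈ U.powerset.erase ∅,
          3 / 2 * (((U.card - S.card) ! : ℝ) * 2 ^ (U.card - S.card)) := by
      refine Finset.sum_le_sum fun S hS => ?_
      rw [Finset.mem_erase, Finset.mem_powerset] at hS
      have hlt : U \ S ⊂ U := Finset.sdiff_ssubset hS.2 (Finset.nonempty_iff_ne_empty.2 hS.1)
      have := (ih _ hlt).2
      rwa [Finset.card_sdiff_of_subset hS.2] at this
    have h3 := sum_powerset_card U
      (fun j => 3 / 2 * (((U.card - j) ! : ℝ) * 2 ^ (U.card - j)))
    -- The term of the empty set is split off: the top class is nonempty, and this is what lowers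
    -- 5/3 to 2/3.
    rw [← Finset.add_sum_erase _ _ (Finset.empty_mem_powerset U)] at h3
    have h4 := sum_choose_mul_le U.card
    have h5 : ∑ j ∈ Finset.range (U.card + 1), (U.card.choose j : ℝ) *
        (3 / 2 * (((U.card - j) ! : ℝ) * 2 ^ (U.card - j))) = 3 / 2 *
        ∑ j ∈ Finset.range (U.card + 1), (U.card.choose j : ℝ) *
          (((U.card - j) ! : ℝ) * 2 ^ (U.card - j)) := by
      rw [Finset.mul_sum]
      exact Finset.sum_congr rfl fun j _ => by ring
    rw [h5] at h3
    simp only [Finset.card_empty, Nat.sub_zero] at h3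
    linarith
  refine ⟨hD, ?_⟩
  have h1 : ((denseArrangements U).card : ℝ) ≤ (topDenseArrangements U).card +
      ∑ c ∈ U, ((topDenseArrangements (U \ {c})).card : ℝ) := by
    have := (Finset.card_le_card (denseArrangements_subset U)).trans
      ((Finset.card_union_le _ _).trans (Nat.add_le_add_left
        (Finset.card_biUnion_le.trans (Finset.sum_le_sum fun S _ => Finset.card_image_le)) _))
    exact_mod_cast this
  have h2 : ∑ c ∈ U, ((topDenseArrangements (U \ {c})).card : ℝ) ≤
      ∑ c ∈ U, (((U.card - 1) ! : ℝ) * 2 ^ (U.card - 1)) := by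
    refine Finset.sum_le_sum fun c hc => ?_
    have hs : ({c} : Finset α) ⊆ U := Finset.singleton_subset_iff.2 hc
    have := (ih _ (Finset.sdiff_ssubset hs (Finset.singleton_nonempty c))).1
    rwa [Finset.card_sdiff_of_subset hs, Finset.card_singleton] at this
  rw [Finset.sum_const, nsmul_eq_mul] at h2
  have h3 : (U.card : ℝ) * (((U.card - 1) ! : ℝ) * 2 ^ (U.card - 1)) ≤
      1 / 2 * ((U.card ! : ℝ) * 2 ^ U.card) := by
    rcases Nat.eq_zero_or_pos U.card with h0 | h0
    · rw [h0]; simp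
    · obtain ⟨v, hv⟩ := Nat.exists_eq_succ_of_ne_zero h0.ne'
      rw [hv, Nat.factorial_succ, pow_succ]
      push_cast
      apply le_of_eq
      simp
      ring
  linarith

/-- Not all block sizes need occur, so the subsets of used sizes are summed over. The constant is
3/2 · 5/3. -/
theorem sum_card_denseArrangements_le (U : Finset α) :
    ∑ S ∈ U.powerset, ((denseArrangements S).card : ℝ) ≤ 5 / 2 * ((U.card ! : ℝ) * 2 ^ U.card) := by
  have h1 : ∑ S ∈ U.powerset, ((denseArrangements S).card : ℝ) ≤
      ∑ S ∈ U.powerset, 3 / 2 * ((S.card ! : ℝ) * 2 ^ S.card) :=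
    Finset.sum_le_sum fun S _ => (card_denseArrangements_le S).2
  have h2 := sum_powerset_card U fun j => 3 / 2 * ((j ! : ℝ) * 2 ^ j)
  rw [← Finset.sum_range_reflect] at h2
  have h3 : ∑ j ∈ Finset.range (U.card + 1), (U.card.choose (U.card + 1 - 1 - j) : ℝ) *
      (3 / 2 * (((U.card + 1 - 1 - j) ! : ℝ) * 2 ^ (U.card + 1 - 1 - j))) = 3 / 2 *
      ∑ j ∈ Finset.range (U.card + 1), (U.card.choose j : ℝ) *
          (((U.card - j) ! : ℝ) * 2 ^ (U.card - j)) := by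
    rw [Finset.mul_sum]
    refine Finset.sum_congr rfl fun j hj => ?_
    rw [Nat.add_sub_cancel, Nat.choose_symm (Nat.lt_succ_iff.1 (Finset.mem_range.1 hj))]
    ring
  have h4 := sum_choose_mul_le U.card
  linarith

end Counting

/-! ### Lower bound for all arrangements -/

section CountingBelow

variable {α : Type*} [DecidableEq α]

theorem IsArrangement.extend {U S : Finset α} {R : Finset (α × α)} (h : IsArrangement (U \ S) R)
    (hS : S ⊆ U) {b : Bool} (hb : b = true ∨ S.card ≤ 1) :
    IsArrangement U (extend U S b R) where
  left_mem x y hxy := by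
    rcases mem_extend.1 hxy with h1 | h1 | h1
    exacts [(Finset.mem_sdiff.1 (h.left_mem _ _ h1)).1, h1.1.1, hS h1.2.1]
  right_mem x y hxy := by
    rcases mem_extend.1 hxy with h1 | h1 | h1
    exacts [(Finset.mem_sdiff.1 (h.right_mem _ _ h1)).1, hS h1.2, hS h1.2.2]
  trans x y z hxy hyz := by
    rw [mem_extend] at *
    rcases hxy with h1 | h1 | h1 <;> rcases hyz with h2 | h2 | h2
    · exact Or.inl (h.trans _ _ _ h1 h2)
    · exact Or.inr (Or.inl ⟨Finset.mem_sdiff.1 (h.left_mem _ _ h1), h2.2⟩)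
    · exact ((Finset.mem_sdiff.1 (h.right_mem _ _ h1)).2 h2.2.1).elim
    · exact ((Finset.mem_sdiff.1 (h.left_mem _ _ h2)).2 h1.2).elim
    · exact (h2.1.2 h1.2).elim
    · exact Or.inr (Or.inl ⟨h1.1, h2.2.2⟩)
    · exact ((Finset.mem_sdiff.1 (h.left_mem _ _ h2)).2 h1.2.2).elim
    · exact (h2.1.2 h1.2.2).elim
    · exact Or.inr (Or.inr ⟨h1.1, h1.2.1, h2.2.2⟩)
  total x hx y hy hne := by
    simp only [mem_extend]
    by_cases hxS : x ∈ S <;> by_cases hyS : y ∈ S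
    · have : b = true := hb.resolve_right fun hc => hne (Finset.card_le_one.1 hc x hxS y hyS)
      exact Or.inl (Or.inr (Or.inr ⟨this, hxS, hyS⟩))
    · exact Or.inr (Or.inr (Or.inl ⟨⟨hy, hyS⟩, hxS⟩))
    · exact Or.inl (Or.inr (Or.inl ⟨⟨hx, hxS⟩, hyS⟩))
    · exact (h.total x (Finset.mem_sdiff.2 ⟨hx, hxS⟩) y (Finset.mem_sdiff.2 ⟨hy, hyS⟩) hne).imp
        Or.inl Or.inl

theorem IsArrangement.topClass_extend {U S : Finset α} {R : Finset (α × α)}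
    (h : IsArrangement (U \ S) R) (hS : S ⊆ U) (hne : S.Nonempty) {b : Bool}
    (hb : b = true ∨ S.card ≤ 1) : topClass U (LinHom.extend U S b R) = S := by
  ext x
  rw [mem_topClass]
  constructor
  · rintro ⟨hx, hxt⟩
    by_contra hxS
    obtain ⟨y, hy⟩ := hne
    rcases mem_extend.1 (hxt y (hS hy) fun e => hxS (e ▸ hy)) with h1 | h1 | h1
    · exact (Finset.mem_sdiff.1 (h.left_mem _ _ h1)).2 hy
    · exact hxS h1.2
    · exact hxS h1.2.2
  · intro hx
    refine ⟨hS hx, fun y hy hyx => ?_⟩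
    rw [mem_extend]
    by_cases hyS : y ∈ S
    · exact Or.inr (Or.inr ⟨hb.resolve_right fun hc => hyx (Finset.card_le_one.1 hc y hyS x hx),
        hyS, hx⟩)
    · exact Or.inr (Or.inl ⟨⟨hy, hyS⟩, hx⟩)

theorem IsArrangement.restrict_extend {U S : Finset α} {R : Finset (α × α)}
    (h : IsArrangement (U \ S) R) (b : Bool) :
    LinHom.restrict (U \ S) (LinHom.extend U S b R) = R := by
  ext ⟨x, y⟩
  rw [mem_restrict, mem_extend]
  constructor
  · rintro ⟨h1 | h1 | h1, hx, hy⟩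
    · exact h1
    · exact ((Finset.mem_sdiff.1 hy).2 h1.2).elim
    · exact ((Finset.mem_sdiff.1 hy).2 h1.2.2).elim
  · exact fun hxy => ⟨Or.inl hxy, h.left_mem _ _ hxy, h.right_mem _ _ hxy⟩

theorem IsArrangement.extend_flag {U S : Finset α} {R : Finset (α × α)}
    (h : IsArrangement (U \ S) R) {b : Bool} {x : α} (hx : x ∈ S) :
    (x, x) ∈ LinHom.extend U S b R ↔ b = true := by
  rw [mem_extend]
  constructor
  · rintro (h1 | h1 | h1)
    · exact ((Finset.mem_sdiff.1 (h.left_mem _ _ h1)).2 hx).elim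
    · exact (h1.1.2 hx).elim
    · exact h1.1
  · exact fun hb => Or.inr (Or.inr ⟨hb, hx, hx⟩)

/-- The top class, the flag and the remainder can all be read off from the extension, so different
choices give different arrangements. The last condition in `hJ` excludes irreflexive classes with
several elements, which would not be total. -/
theorem sum_le_card_arrangements (U : Finset α) (J : Finset (Finset α × Bool))
    (hJ : ∀ p ∈ J, p.1 ⊆ U ∧ p.1.Nonempty ∧ (p.2 = true ∨ p.1.card ≤ 1)) :
    ∑ p ∈ J, (arrangements (U \ p.1)).card ≤ (arrangements U).card := by
  rw [← Finset.card_sigma]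
  refine Finset.card_le_card_of_injOn (fun x => extend U x.1.1 x.1.2 x.2) ?_ ?_
  · rintro ⟨p, R⟩ hx
    obtain ⟨hp, hR⟩ := Finset.mem_sigma.1 hx
    obtain ⟨h1, -, h3⟩ := hJ p hp
    exact mem_arrangements.2 ((mem_arrangements.1 hR).extend h1 h3)
  · rintro ⟨⟨S, b⟩, R⟩ hx ⟨⟨S', b'⟩, R'⟩ hx' heq
    obtain ⟨hp, hR⟩ := Finset.mem_sigma.1 hx
    obtain ⟨hp', hR'⟩ := Finset.mem_sigma.1 hx'
    obtain ⟨h1, h2, h3⟩ := hJ _ hp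
    obtain ⟨h1', h2', h3'⟩ := hJ _ hp'
    simp only at heq h1 h2 h3 h1' h2' h3' hR hR'
    rw [mem_arrangements] at hR hR'
    have hS : S = S' := by
      rw [← hR.topClass_extend h1 h2 h3, heq, hR'.topClass_extend h1' h2' h3']
    subst hS
    have hb : b = b' := by
      obtain ⟨x, hx⟩ := h2
      rw [Bool.eq_iff_iff, ← hR.extend_flag (b := b) hx, heq, hR'.extend_flag hx]
    subst hb
    have : R = R' := by
      rw [← hR.restrict_extend b, heq, hR'.restrict_extend b]
    rw [this]

/-- Only top classes of size one (two kinds) and two are used. With b_u = a_u/u!, this gives b_u ≥ 2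
b_{u-1} + b_{u-2}/2, whose growth rate 1 + √(3/2) exceeds 11/5. -/
theorem le_card_arrangements (U : Finset α) :
    10 / 11 * ((U.card ! : ℝ) * (11 / 5) ^ U.card) ≤ ((arrangements U).card : ℝ) := by
  have h0 : (1 : ℝ) ≤ (arrangements (∅ : Finset α)).card := by
    have : ∅ ∈ arrangements (∅ : Finset α) :=
      mem_arrangements.2 ⟨by simp, by simp, by simp, by simp⟩
    exact_mod_cast Finset.card_pos.2 ⟨_, this⟩
  induction U using Finset.strongInduction with
  | H U ih =>
  rcases U.eq_empty_or_nonempty with rfl | hU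
  · simp
    linarith
  have hlow : ∀ S ∈ U.powerset, S.Nonempty →
      10 / 11 * (((U.card - S.card) ! : ℝ) * (11 / 5) ^ (U.card - S.card)) ≤
        ((arrangements (U \ S)).card : ℝ) := by
    intro S hS hne
    have hS := Finset.mem_powerset.1 hS
    have := ih _ (Finset.sdiff_ssubset hS hne)
    rwa [Finset.card_sdiff_of_subset hS] at this
  let J₁ : Finset (Finset α × Bool) := U.powersetCard 1 ×ˢ Finset.univ
  let J₂ : Finset (Finset α × Bool) := U.powersetCard 2 ×ˢ {true}
  have hdisj : Disjoint J₁ J₂ := by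
    rw [Finset.disjoint_left]
    intro p h1 h2
    have h1 := (Finset.mem_powersetCard.1 (Finset.mem_product.1 h1).1).2
    have h2 := (Finset.mem_powersetCard.1 (Finset.mem_product.1 h2).1).2
    omega
  have hsum := sum_le_card_arrangements U (J₁ ∪ J₂) (by
    intro p hp
    rcases Finset.mem_union.1 hp with h | h <;> rw [Finset.mem_product] at h
    · have h1 := Finset.mem_powersetCard.1 h.1
      exact ⟨h1.1, Finset.card_pos.1 (by omega), Or.inr h1.2.le⟩
    · have h1 := Finset.mem_powersetCard.1 h.1
      exact ⟨h1.1, Finset.card_pos.1 (by omega), Or.inl (Finset.mem_singleton.1 h.2)⟩)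
  rw [Finset.sum_union hdisj, Finset.sum_product, Finset.sum_product] at hsum
  simp only [Fintype.sum_bool, Finset.sum_singleton] at hsum
  have h1 : U.card * (2 * (10 / 11 * (((U.card - 1) ! : ℝ) * (11 / 5) ^ (U.card - 1)))) ≤
      ∑ S ∈ U.powersetCard 1,
        (((arrangements (U \ S)).card : ℝ) + ((arrangements (U \ S)).card : ℝ)) := by
    have : ∀ S ∈ U.powersetCard 1,
        2 * (10 / 11 * (((U.card - 1) ! : ℝ) * (11 / 5) ^ (U.card - 1))) ≤
        (((arrangements (U \ S)).card : ℝ) + ((arrangements (U \ S)).card : ℝ)) := by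
      intro S hS
      obtain ⟨hS, hc⟩ := Finset.mem_powersetCard.1 hS
      have := hlow S (Finset.mem_powerset.2 hS) (Finset.card_pos.1 (by omega))
      rw [hc] at this
      linarith
    have := Finset.card_nsmul_le_sum _ _ _ this
    rwa [Finset.card_powersetCard, Nat.choose_one_right, nsmul_eq_mul] at this
  have h2 : (U.card.choose 2 : ℝ) * (10 / 11 * (((U.card - 2) ! : ℝ) * (11 / 5) ^ (U.card - 2))) ≤
      ∑ S ∈ U.powersetCard 2, ((arrangements (U \ S)).card : ℝ) := by
    have : ∀ S ∈ U.powersetCard 2,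
        10 / 11 * (((U.card - 2) ! : ℝ) * (11 / 5) ^ (U.card - 2)) ≤
        ((arrangements (U \ S)).card : ℝ) := by
      intro S hS
      obtain ⟨hS, hc⟩ := Finset.mem_powersetCard.1 hS
      have := hlow S (Finset.mem_powerset.2 hS) (Finset.card_pos.1 (by omega))
      rwa [hc] at this
    have := Finset.card_nsmul_le_sum _ _ _ this
    rwa [Finset.card_powersetCard, nsmul_eq_mul] at this
  have h3 : ∑ S ∈ U.powersetCard 1,
        (((arrangements (U \ S)).card : ℝ) + ((arrangements (U \ S)).card : ℝ)) +
      ∑ S ∈ U.powersetCard 2, ((arrangements (U \ S)).card : ℝ) ≤ (arrangements U).card := by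
    exact_mod_cast hsum
  obtain ⟨u, hu⟩ := Nat.exists_eq_succ_of_ne_zero (Finset.card_pos.2 hU).ne'
  -- For one color the bound 10/11 · 11/5 = 2 is attained by the two kinds of classes; this case
  -- fixes the constant 10/11.
  rcases u with _ | u
  · have hS : ∀ S ∈ U.powersetCard 1, U \ S = ∅ := fun S hS => by
      obtain ⟨hS, hc⟩ := Finset.mem_powersetCard.1 hS
      rw [Finset.eq_of_subset_of_card_le hS (by omega), sdiff_self, Finset.bot_eq_empty]
    have h4 : ∑ S ∈ U.powersetCard 1,
        (((arrangements (U \ S)).card : ℝ) + ((arrangements (U \ S)).card : ℝ)) =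
        ((arrangements (∅ : Finset α)).card : ℝ) + (arrangements (∅ : Finset α)).card := by
      rw [Finset.sum_congr rfl fun S h => by rw [hS S h]]
      simp [hu]
    have h5 : 0 ≤ ∑ S ∈ U.powersetCard 2, ((arrangements (U \ S)).card : ℝ) :=
      Finset.sum_nonneg fun _ _ => Nat.cast_nonneg _
    have h6 : (2 : ℝ) ≤ (arrangements U).card := by linarith
    rw [hu]
    refine le_trans (le_of_eq ?_) h6
    norm_num
  · refine le_trans ?_ ((add_le_add h1 h2).trans h3)
    rw [hu]
    have hc : ((u + 1 + 1).choose 2 : ℝ) = (u + 2) * (u + 1) / 2 := by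
      rw [Nat.cast_choose_two]; push_cast; ring
    have e1 : (u + 1).succ - 1 = u + 1 := rfl
    have e2 : (u + 1).succ - 2 = u := rfl
    rw [e1, e2, Nat.succ_eq_add_one, hc, Nat.factorial_succ (u + 1), Nat.factorial_succ u,
      pow_succ, pow_succ]
    push_cast
    -- After this positive quantity is factored out, the claim is (11/5)^2 = 4.84 ≤ 4.9 = 2 · 11/5 +
    -- 1/2.
    have : 0 ≤ (u + 2 : ℝ) * (u + 1) * (u ! : ℝ) * (11 / 5) ^ u := by positivity
    linarith

end CountingBelow

open FirstOrder

/-! ### Homogeneous colored orderings are the saturated ones -/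

section Colored

/-- It suffices that equal values of `inv` imply equivalence: `inv` need not be constant on classes,
since it is evaluated at one chosen representative of each. -/
theorem quotient_image_finite_and_ncard_le {T ι : Type*} [s : Setoid T] (P : Set T) (inv : T → ι)
    (V : Finset ι) (hV : ∀ X ∈ P, inv X ∈ V)
    (hinj : ∀ X ∈ P, ∀ Y ∈ P, inv X = inv Y → X ≈ Y) :
    (Quotient.mk s '' P).Finite ∧ (Quotient.mk s '' P).ncard ≤ V.card := by
  have h : ∀ q : Quotient s, ∃ i : Option ι,
      ∀ h : q ∈ Quotient.mk s '' P, i = some (inv h.choose) :=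
    fun q => by
      by_cases h : q ∈ Quotient.mk s '' P
      · exact ⟨some (inv h.choose), fun _ => rfl⟩
      · exact ⟨none, fun h' => (h h').elim⟩
  choose g hg using h
  have hmaps : Set.MapsTo g (Quotient.mk s '' P) ↑(V.map Function.Embedding.some) := fun q hq => by
    rw [hg q hq]
    simpa using hV _ hq.choose_spec.1
  have hinj' : Set.InjOn g (Quotient.mk s '' P) := fun q hq q' hq' h => by
    rw [hg q hq, hg q' hq', Option.some_inj] at h
    rw [← hq.choose_spec.2, ← hq'.choose_spec.2]
    exact Quotient.sound (hinj _ hq.choose_spec.1 _ hq'.choose_spec.1 h)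
  have hfin := (V.map Function.Embedding.some).finite_toSet
  refine ⟨Set.Finite.of_injOn hmaps hinj' hfin, ?_⟩
  have := Set.ncard_le_ncard_of_injOn g hmaps hinj' hfin
  rwa [Set.ncard_coe_finset, Finset.card_map] at this

instance (k : ℕ) : (ColorLang k).IsRelational := fun _ => inferInstanceAs (IsEmpty Empty)

variable {k : ℕ}

attribute [instance] ColoredLinOrd.countable

/-- In a relational language the substructure generated by a set is the set itself, so a finite
partial isomorphism is an embedding of a finitely generated substructure. The conclusion has the
form needed in `IsSaturated.of_homogeneous`. -/
theorem colored_homogeneous (X : ColoredLinOrd k) (hX : (ColorLang k).IsUltrahomogeneous X.carrier)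
    (F : Finset (X.carrier × X.carrier)) (hF : IsPartialIso X.color X.color F) :
    ∃ g : X.carrier → X.carrier, StrictMono g ∧ (∀ x, X.color (g x) = X.color x) ∧
      ∀ p ∈ F, g p.1 = p.2 := by
  classical
  have hw : ∀ x, ∃ y, ∀ p ∈ F, p.1 = x → p.2 = y := fun x => by
    by_cases h : ∃ p ∈ F, p.1 = x
    · obtain ⟨p, hp, rfl⟩ := h
      exact ⟨p.2, fun q hq h => (hF.eq_iff hq hp).1 h⟩
    · exact ⟨x, fun p hp hx => (h ⟨p, hp, hx⟩).elim⟩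
  choose w hw using hw
  have hw : ∀ p ∈ F, p.2 = w p.1 := fun p hp => hw _ p hp rfl
  let S : (ColorLang k).Substructure X.carrier :=
    Language.Substructure.closure (ColorLang k) (F.image Prod.fst : Finset X.carrier)
  have hmem : ∀ x : S, ∃ p ∈ F, p.1 = x.1 := fun x => by
    have := (Language.Substructure.mem_closure_iff_of_isRelational (ColorLang k) _ _).1 x.2
    simpa using this
  have hlt : ∀ x y : S, w x.1 < w y.1 ↔ x.1 < y.1 := fun x y => by
    obtain ⟨p, hp, hpx⟩ := hmem x
    obtain ⟨q, hq, hqx⟩ := hmem y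
    rw [← hpx, ← hqx, ← hw p hp, ← hw q hq]
    exact (hF.2 p hp q hq).symm
  have hcol : ∀ x : S, X.color (w x.1) = X.color x.1 := fun x => by
    obtain ⟨p, hp, hpx⟩ := hmem x
    rw [← hpx, ← hw p hp]
    exact hF.1 p hp
  let f : S ↪[ColorLang k] X.carrier :=
    { toFun := fun x => w x.1
      inj' := fun x y h => by
        have h1 := hlt x y
        have h2 := hlt y x
        simp only at h
        rw [h] at h1 h2
        exact Subtype.ext (le_antisymm (not_lt.1 fun hh => lt_irrefl _ (h2.2 hh))
          (not_lt.1 fun hh => lt_irrefl _ (h1.2 hh)))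
      map_fun' := fun f => Empty.elim f
      map_rel' := fun r v => by
        cases r with
        | lt => exact hlt (v 0) (v 1)
        | color i => exact Eq.congr_left (hcol (v 0)) }
  obtain ⟨g, hg⟩ := hX S (Language.Substructure.fg_closure (Finset.finite_toSet _)) f
  refine ⟨g, fun x y hxy => ?_, fun x => ?_, fun p hp => ?_⟩
  · exact (g.map_rel (ColorRel.lt : (ColorLang k).Relations 2) ![x, y]).2 hxy
  · exact (g.map_rel (ColorRel.color (X.color x) : (ColorLang k).Relations 1) ![x]).2 rfl
  · have hpS : p.1 ∈ S := Language.Substructure.subset_closure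
      (Finset.mem_coe.2 (Finset.mem_image_of_mem _ hp))
    have := DFunLike.congr_fun hg ⟨p.1, hpS⟩
    rw [hw p hp]
    exact this.symm

theorem IsSaturated.isUltrahomogeneous (X : ColoredLinOrd k) (hX : IsSaturated X.color) :
    (ColorLang k).IsUltrahomogeneous X.carrier := by
  classical
  intro S hS f
  have hfin : Finite S := hS.finite
  have := Fintype.ofFinite S
  let F : Finset (X.carrier × X.carrier) := Finset.univ.image fun x : S => (x.1, f x)
  have hF : IsPartialIso X.color X.color F := by
    constructor
    · intro p hp
      obtain ⟨x, -, rfl⟩ := Finset.mem_image.1 hp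
      exact (f.map_rel (ColorRel.color (X.color x.1) : (ColorLang k).Relations 1) ![x]).2 rfl
    · intro p hp q hq
      obtain ⟨x, -, rfl⟩ := Finset.mem_image.1 hp
      obtain ⟨y, -, rfl⟩ := Finset.mem_image.1 hq
      exact (f.map_rel (ColorRel.lt : (ColorLang k).Relations 2) ![x, y]).symm
  obtain ⟨e, hc, he⟩ := hX.exists_orderIso hX (fun _ => Iff.rfl) (fun _ _ => Iff.rfl) hF
  refine ⟨{ e.toEquiv with
      map_fun' := fun f => Empty.elim f
      map_rel' := fun r v => by
        cases r with
        | lt => exact e.lt_iff_lt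
        | color i => exact Eq.congr_left (hc (v 0)) }, ?_⟩
  ext x
  exact (he _ (Finset.mem_image_of_mem _ (Finset.mem_univ x))).symm

open Classical in
/-- The used colors and the relation `ColorBefore` as finsets. -/
noncomputable def colorInvariant {X κ : Type*} [LinearOrder X] (K : Finset κ) (c : X → κ) :
    Finset κ × Finset (κ × κ) :=
  (K.filter fun a => ∃ x, c x = a, (K ×ˢ K).filter fun p => ColorBefore c p.1 p.2)

theorem IsSaturated.exists_orderIso_of_colorInvariant_eq {X Y κ : Type*} [LinearOrder X]
    [LinearOrder Y] [Countable X] [Countable Y] {cX : X → κ} {cY : Y → κ}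
    (hX : IsSaturated cX) (hY : IsSaturated cY) {K : Finset κ} (hcX : ∀ x, cX x ∈ K)
    (hcY : ∀ y, cY y ∈ K) (h : colorInvariant K cX = colorInvariant K cY) :
    ∃ e : X ≃o Y, ∀ x, cY (e x) = cX x := by
  classical
  obtain ⟨h1, h2⟩ := Prod.ext_iff.1 h
  simp only [colorInvariant, Finset.ext_iff, Finset.mem_filter, Finset.mem_product, Prod.forall]
    at h1 h2
  have hU : ∀ c, (∃ x, cX x = c) ↔ ∃ y, cY y = c := fun c => by
    constructor
    · rintro ⟨x, rfl⟩
      exact ((h1 _).1 ⟨hcX x, x, rfl⟩).2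
    · rintro ⟨y, rfl⟩
      exact ((h1 _).2 ⟨hcY y, y, rfl⟩).2
  have hR : ∀ c d, ColorBefore cX c d ↔ ColorBefore cY c d := fun c d => by
    constructor
    · intro h
      have h' := h
      obtain ⟨x, y, -, rfl, rfl⟩ := h'
      exact ((h2 _ _).1 ⟨⟨hcX x, hcX y⟩, h⟩).2
    · intro h
      have h' := h
      obtain ⟨x, y, -, rfl, rfl⟩ := h'
      exact ((h2 _ _).2 ⟨⟨hcY x, hcY y⟩, h⟩).2
  obtain ⟨e, he, -⟩ := hX.exists_orderIso hY hU hR (F := ∅) (by simp [IsPartialIso])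
  exact ⟨e, he⟩

theorem colorHomTypes_finite (k : ℕ) : (colorHomTypes k).Finite := by
  classical
  refine (quotient_image_finite_and_ncard_le _
    (fun X : ColoredLinOrd k => colorInvariant Finset.univ X.color) Finset.univ
    (fun _ _ => Finset.mem_univ _) ?_).1
  intro X hX Y hY h
  exact (IsSaturated.of_homogeneous (colored_homogeneous X hX)).exists_orderIso_of_colorInvariant_eq
    (IsSaturated.of_homogeneous (colored_homogeneous Y hY)) (fun _ => Finset.mem_univ _)
    (fun _ => Finset.mem_univ _) h

end Colored

/-! ### Every arrangement is realized by a homogeneous colored ordering -/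

section Realization

open Classical

variable {k : ℕ} {R : Finset (Fin k × Fin k)}

/-- The number of colors strictly below `c`. -/
noncomputable def colorRank (R : Finset (Fin k × Fin k)) (c : Fin k) : ℕ :=
  (Finset.univ.filter fun e => (e, c) ∈ R ∧ (c, e) ∉ R).card

theorem IsArrangement.colorRank_lt (h : IsArrangement Finset.univ R) {c d : Fin k}
    (hcd : (c, d) ∈ R) (hdc : (d, c) ∉ R) : colorRank R c < colorRank R d := by
  refine Finset.card_lt_card ⟨fun e he => ?_, fun hs => ?_⟩
  · simp only [Finset.mem_filter, Finset.mem_univ, true_and] at he ⊢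
    exact ⟨h.trans _ _ _ he.1 hcd, fun hde => hdc (h.trans _ _ _ hde he.1)⟩
  · have : c ∈ Finset.univ.filter fun e => (e, d) ∈ R ∧ (d, e) ∉ R := by simp [hcd, hdc]
    have := hs this
    simp at this

theorem IsArrangement.colorRank_eq (h : IsArrangement Finset.univ R) {c d : Fin k}
    (hcd : (c, d) ∈ R) (hdc : (d, c) ∈ R) : colorRank R c = colorRank R d := by
  unfold colorRank
  congr 1
  ext e
  simp only [Finset.mem_filter, Finset.mem_univ, true_and]
  exact ⟨fun he => ⟨h.trans _ _ _ he.1 hcd, fun hde => he.2 (h.trans _ _ _ hcd hde)⟩,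
    fun he => ⟨h.trans _ _ _ he.1 hdc, fun hde => he.2 (h.trans _ _ _ hdc hde)⟩⟩

/-- The points of the realization: a copy of `ℚ` for each reflexive color and a single point
for the other colors. -/
def Realization (R : Finset (Fin k × Fin k)) : Type :=
  {p : Fin k × ℚ // (p.1, p.1) ∈ R ∨ p.2 = 0}

/-- The position of a point within its class. -/
noncomputable def Realization.pos (x : Realization R) : ℝ := x.1.2 + x.1.1 * √2

/-- Color `c` occupies rationals shifted by `c * √2`. As √2 is irrational, different colors never
collide, while each reflexive color is dense in ℝ. -/
theorem Realization.pos_injective : Function.Injective (Realization.pos (R := R)) := by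
  rintro ⟨⟨c, q⟩, hx⟩ ⟨⟨d, r⟩, hy⟩ h
  simp only [pos] at h
  have hcd : c = d := by
    by_contra hne
    have hne' : ((c.1 : ℤ) - d.1 : ℤ) ≠ 0 := fun e => hne (Fin.ext (by omega))
    refine (irrational_sqrt_two.intCast_mul hne').ne_rat (r - q) ?_
    push_cast
    linarith
  subst hcd
  have : q = r := by exact_mod_cast add_right_cancel h
  subst this
  rfl

noncomputable instance : LinearOrder (Realization R) :=
  LinearOrder.lift' (fun x => toLex (colorRank R x.1.1, x.pos)) fun _ _ h =>
    Realization.pos_injective (congrArg (fun r => (ofLex r).2) h)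

instance : Countable (Realization R) := by
  unfold Realization
  infer_instance

theorem Realization.lt_iff {x y : Realization R} : x < y ↔
    colorRank R x.1.1 < colorRank R y.1.1 ∨
      colorRank R x.1.1 = colorRank R y.1.1 ∧ x.pos < y.pos :=
  Prod.Lex.lt_iff (x := toLex (colorRank R x.1.1, x.pos)) (y := toLex (colorRank R y.1.1, y.pos))

/-- The color of a point. -/
def Realization.color (x : Realization R) : Fin k := x.1.1

/-- The distinguished point of each color. -/
def Realization.base (c : Fin k) : Realization R := ⟨(c, 0), Or.inr rfl⟩

theorem Realization.exists_between {c : Fin k} (hc : (c, c) ∈ R) {a b : ℝ} (hab : a < b) :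
    ∃ x : Realization R, x.color = c ∧ a < x.pos ∧ x.pos < b := by
  obtain ⟨q, h1, h2⟩ := exists_rat_btwn (sub_lt_sub_right hab (c * √2))
  exact ⟨⟨(c, q), Or.inl hc⟩, rfl, by simp only [pos]; linarith, by simp only [pos]; linarith⟩

theorem IsArrangement.rel_of_lt (h : IsArrangement Finset.univ R) {x y : Realization R}
    (hxy : x < y) : (x.color, y.color) ∈ R := by
  by_cases hc : x.color = y.color
  · by_contra hn
    refine hxy.ne (Subtype.ext (Prod.ext hc ?_))
    have h1 := x.2.resolve_left (by rw [← hc] at hn; exact hn)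
    have h2 := y.2.resolve_left (by rw [hc] at hn; exact hn)
    rw [h1, h2]
  · by_contra hn
    have hyx := (h.total _ (Finset.mem_univ _) _ (Finset.mem_univ _) hc).resolve_left hn
    have h1 : colorRank R y.1.1 < colorRank R x.1.1 := h.colorRank_lt hyx hn
    rcases Realization.lt_iff.1 hxy with h2 | h2
    · exact lt_asymm h1 h2
    · exact h1.ne' h2.1

theorem IsArrangement.exists_above (h : IsArrangement Finset.univ R) (x : Realization R)
    {c : Fin k} (hc : (x.color, c) ∈ R) : ∃ y, x < y ∧ y.color = c := by
  by_cases hc' : (c, x.color) ∈ R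
  · obtain ⟨y, hy, h1, -⟩ := Realization.exists_between (h.trans _ _ _ hc' hc) (lt_add_one x.pos)
    subst hy
    exact ⟨y, Realization.lt_iff.2 (Or.inr ⟨h.colorRank_eq hc hc', h1⟩), rfl⟩
  · exact ⟨Realization.base c, Realization.lt_iff.2 (Or.inl (h.colorRank_lt hc hc')), rfl⟩

theorem IsArrangement.exists_below (h : IsArrangement Finset.univ R) (x : Realization R)
    {c : Fin k} (hc : (c, x.color) ∈ R) : ∃ y, y < x ∧ y.color = c := by
  by_cases hc' : (x.color, c) ∈ R
  · obtain ⟨y, hy, -, h1⟩ := Realization.exists_between (h.trans _ _ _ hc hc') (sub_one_lt x.pos)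
    subst hy
    exact ⟨y, Realization.lt_iff.2 (Or.inr ⟨h.colorRank_eq hc hc', h1⟩), rfl⟩
  · exact ⟨Realization.base c, Realization.lt_iff.2 (Or.inl (h.colorRank_lt hc hc')), rfl⟩

theorem IsArrangement.colorBefore_iff (h : IsArrangement Finset.univ R) (c d : Fin k) :
    ColorBefore (Realization.color (R := R)) c d ↔ (c, d) ∈ R := by
  constructor
  · rintro ⟨x, y, hxy, rfl, rfl⟩
    exact h.rel_of_lt hxy
  · intro hcd
    obtain ⟨y, h1, h2⟩ := h.exists_above (Realization.base c) hcd
    exact ⟨_, y, h1, rfl, h2⟩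

/-- If `c` shares its class with both ends, density of its copy of ℚ gives the point. Otherwise `c`
is in a class strictly apart from one end, and a point on the correct side of the other end
suffices. -/
theorem IsArrangement.isSaturated (h : IsArrangement Finset.univ R) :
    IsSaturated (Realization.color (R := R)) where
  above x c hc := h.exists_above x ((h.colorBefore_iff _ _).1 hc)
  below x c hc := h.exists_below x ((h.colorBefore_iff _ _).1 hc)
  between x y c hxy hxc hcy := by
    rw [h.colorBefore_iff] at hxc hcy
    by_cases hcx : (c, x.color) ∈ R
    · have hr : colorRank R x.1.1 = colorRank R c := h.colorRank_eq hxc hcx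
      by_cases hyc : (y.color, c) ∈ R
      · have hr' : colorRank R c = colorRank R y.1.1 := h.colorRank_eq hcy hyc
        have hpos : x.pos < y.pos := by
          rcases Realization.lt_iff.1 hxy with h1 | h1
          · omega
          · exact h1.2
        obtain ⟨z, hz, h1, h2⟩ := Realization.exists_between (h.trans _ _ _ hcx hxc) hpos
        subst hz
        exact ⟨z, Realization.lt_iff.2 (Or.inr ⟨hr, h1⟩),
          Realization.lt_iff.2 (Or.inr ⟨hr', h2⟩), rfl⟩
      · obtain ⟨z, h1, rfl⟩ := h.exists_above x hxc
        exact ⟨z, h1, Realization.lt_iff.2 (Or.inl (h.colorRank_lt hcy hyc)), rfl⟩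
    · obtain ⟨z, h1, rfl⟩ := h.exists_below y hcy
      exact ⟨z, Realization.lt_iff.2 (Or.inl (h.colorRank_lt hxc hcx)), h1, rfl⟩

/-- The realization as a colored linear ordering. -/
noncomputable def realizationOrd (R : Finset (Fin k × Fin k)) : ColoredLinOrd k where
  carrier := Realization R
  color := Realization.color

/-- The relation `R` is recovered from the realization as `ColorBefore`, which isomorphisms
preserve. Only orderings in which all k colors occur are counted here, which is enough for a lower
bound. -/
theorem card_arrangements_le_numColored (k : ℕ) :
    (arrangements (Finset.univ : Finset (Fin k))).card ≤ numColored k := by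
  rw [← Set.ncard_coe_finset]
  refine Set.ncard_le_ncard_of_injOn (fun R => Quotient.mk (coloredSetoid k) (realizationOrd R))
    (fun R hR => ?_) (fun R hR R' hR' heq => ?_) (colorHomTypes_finite k)
  · exact ⟨_, IsSaturated.isUltrahomogeneous (realizationOrd R)
      (mem_arrangements.1 hR).isSaturated, rfl⟩
  · obtain ⟨e, he⟩ := Quotient.exact heq
    change Realization R ≃o Realization R' at e
    change ∀ x : Realization R, (e x).color = x.color at he
    ext ⟨c, d⟩
    rw [← (mem_arrangements.1 hR).colorBefore_iff, ← (mem_arrangements.1 hR').colorBefore_iff]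
    constructor
    · rintro ⟨x, y, hxy, rfl, rfl⟩
      exact ⟨e x, e y, e.lt_iff_lt.2 hxy, he x, he y⟩
    · rintro ⟨x, y, hxy, rfl, rfl⟩
      exact ⟨e.symm x, e.symm y, e.symm.lt_iff_lt.2 hxy, by rw [← he, e.apply_symm_apply],
        by rw [← he, e.apply_symm_apply]⟩

theorem le_numColored (k : ℕ) : 10 / 11 * ((k ! : ℝ) * (11 / 5) ^ k) ≤ (numColored k : ℝ) := by
  have h := le_card_arrangements (Finset.univ : Finset (Fin k))
  rw [Finset.card_univ, Fintype.card_fin] at h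
  exact h.trans (by exact_mod_cast card_arrangements_le_numColored k)

end Realization

/-! ### Blocks, and the coordinates (first point, index) when they are finite -/

section Blocks

variable {X : Type} [LinearOrder X]

theorem mem_block_self (x : X) : x ∈ block x := by simp [block]

theorem mem_block_symm {x y : X} (h : y ∈ block x) : x ∈ block y := by
  simpa only [block, Set.mem_ofPred_eq, Set.uIcc_comm] using h

theorem mem_block_trans {x y z : X} (h : y ∈ block x) (h' : z ∈ block y) : z ∈ block x :=
  (Set.Finite.union h h').subset Set.uIcc_subset_uIcc_union_uIcc

theorem block_eq {x y : X} (h : y ∈ block x) : block y = block x :=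
  Set.ext fun _ => ⟨fun hz => mem_block_trans h hz, fun hz => mem_block_trans (mem_block_symm h) hz⟩

theorem mem_block_of_between {x a b z : X} (ha : a ∈ block x) (hb : b ∈ block x) (haz : a ≤ z)
    (hzb : z ≤ b) : z ∈ block x := by
  refine mem_block_trans ha ?_
  have h : b ∈ block a := mem_block_trans (mem_block_symm ha) hb
  refine Set.Finite.subset h ?_
  rw [Set.uIcc_of_le haz, Set.uIcc_of_le (haz.trans hzb)]
  exact Set.Icc_subset_Icc_right hzb

theorem mem_block_of_covBy {x y : X} (h : x ⋖ y) : y ∈ block x := by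
  change (Set.uIcc x y).Finite
  rw [Set.uIcc_of_le h.le, h.Icc_eq]
  exact Set.toFinite _

theorem exists_covBy_le {x y : X} (hxy : x < y) (h : y ∈ block x) : ∃ z, x ⋖ z ∧ z ≤ y := by
  have hfin : (Set.Ioc x y).Finite := by
    refine Set.Finite.subset h ?_
    rw [Set.uIcc_of_le hxy.le]
    exact Set.Ioc_subset_Icc_self
  obtain ⟨z, hz, hmin⟩ := Set.exists_min_image _ id hfin ⟨y, hxy, le_rfl⟩
  exact ⟨z, ⟨hz.1, fun w h1 h2 => (hmin w ⟨h1, h2.le.trans hz.2⟩).not_gt h2⟩, hz.2⟩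

theorem transGen_covBy_of_mem_block {x y : X} (hxy : x < y) (h : y ∈ block x) :
    Relation.TransGen (· ⋖ ·) x y := by
  have hfin : (Set.Ioc x y).Finite := by
    refine Set.Finite.subset h ?_
    rw [Set.uIcc_of_le hxy.le]
    exact Set.Ioc_subset_Icc_self
  induction hn : (Set.Ioc x y).ncard using Nat.strong_induction_on generalizing x with
  | _ n ih =>
  obtain ⟨z, hz, hzy⟩ := exists_covBy_le hxy h
  rcases hzy.eq_or_lt with rfl | hlt
  · exact .single hz
  · have hss : Set.Ioc z y ⊂ Set.Ioc x y :=
      ⟨Set.Ioc_subset_Ioc_left hz.le, fun hs => lt_irrefl z (hs ⟨hz.lt, hzy⟩).1⟩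
    exact .head hz (ih _ (hn ▸ Set.ncard_lt_ncard hss hfin) hlt
      (mem_block_trans (mem_block_symm (mem_block_of_covBy hz)) h) (hfin.subset hss.1) rfl)

theorem transGen_covBy_iff {x y : X} :
    Relation.TransGen (· ⋖ ·) x y ↔ x < y ∧ y ∈ block x := by
  refine ⟨fun h => ?_, fun h => transGen_covBy_of_mem_block h.1 h.2⟩
  induction h with
  | single h => exact ⟨h.lt, (mem_block_of_covBy h)⟩
  | tail _ h ih => exact ⟨ih.1.trans h.lt, mem_block_trans ih.2 (mem_block_of_covBy h)⟩

theorem orderIso_image_block {Y : Type} [LinearOrder Y] (e : X ≃o Y) (x : X) :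
    e '' block x = block (e x) := by
  have key : ∀ {X Y : Type} [LinearOrder X] [LinearOrder Y] (e : X ≃o Y) (x y : X),
      y ∈ block x → e y ∈ block (e x) := by
    intro X Y _ _ e x y h
    refine (Set.Finite.image e h).subset ?_
    intro z hz
    refine ⟨e.symm z, ?_, e.apply_symm_apply z⟩
    simp only [Set.mem_uIcc] at hz ⊢
    simpa only [e.le_symm_apply, e.symm_apply_le] using hz
  ext y
  constructor
  · rintro ⟨z, hz, rfl⟩
    exact key e x z hz
  · intro hy
    refine ⟨e.symm y, ?_, e.apply_symm_apply y⟩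
    simpa using key e.symm _ _ hy

variable (X) in
/-- All blocks are finite. -/
class FiniteBlocks : Prop where
  finite : ∀ x : X, (block x).Finite

/-- The first point of its block. -/
def IsFirst (x : X) : Prop := ∀ y ∈ block x, x ≤ y

/-- The number of points of the block of `x`. -/
noncomputable def blockSize (x : X) : ℕ := (block x).ncard

/-- The number of points before `x` in its block. -/
noncomputable def blockIndex (x : X) : ℕ := (block x ∩ Set.Iio x).ncard

theorem orderIso_isFirst (g : X ≃o X) {x : X} (hx : IsFirst x) : IsFirst (g x) := by
  intro y hy
  rw [← orderIso_image_block] at hy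
  obtain ⟨z, hz, rfl⟩ := hy
  exact g.monotone (hx z hz)

theorem orderIso_blockSize (g : X ≃o X) (x : X) : blockSize (g x) = blockSize x := by
  rw [blockSize, blockSize, ← orderIso_image_block, Set.ncard_image_of_injective _ g.injective]

variable [FiniteBlocks X]

theorem exists_first (x : X) : ∃ a ∈ block x, ∀ b ∈ block x, a ≤ b :=
  Set.exists_min_image _ id (FiniteBlocks.finite x) ⟨x, mem_block_self x⟩

/-- The first point of the block of `x`. -/
noncomputable def first (x : X) : X := (exists_first x).choose

theorem first_mem (x : X) : first x ∈ block x := (exists_first x).choose_spec.1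

theorem first_le_of_mem {x y : X} (h : y ∈ block x) : first x ≤ y :=
  (exists_first x).choose_spec.2 y h

theorem first_le (x : X) : first x ≤ x := first_le_of_mem (mem_block_self x)

theorem isFirst_first (x : X) : IsFirst (first x) := fun _ hy =>
  first_le_of_mem (mem_block_trans (first_mem x) hy)

theorem IsFirst.first_eq {x : X} (h : IsFirst x) : first x = x :=
  le_antisymm (first_le x) (h _ (first_mem x))

theorem first_eq_iff {x y : X} : first x = first y ↔ y ∈ block x := by
  constructor
  · intro h
    exact mem_block_trans (h ▸ first_mem x) (mem_block_symm (first_mem y))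
  · intro h
    exact le_antisymm (first_le_of_mem (mem_block_trans h (first_mem y)))
      (first_le_of_mem (mem_block_trans (mem_block_symm h) (first_mem x)))

theorem first_first (x : X) : first (first x) = first x := (isFirst_first x).first_eq

theorem blockSize_eq {x y : X} (h : first x = first y) : blockSize x = blockSize y := by
  rw [blockSize, blockSize, block_eq (first_eq_iff.1 h)]

theorem blockSize_first (x : X) : blockSize (first x) = blockSize x := blockSize_eq (first_first x)

theorem blockSize_pos (x : X) : 0 < blockSize x :=
  (Set.ncard_pos (FiniteBlocks.finite x)).2 ⟨x, mem_block_self x⟩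

theorem blockIndex_lt_blockSize (x : X) : blockIndex x < blockSize x :=
  Set.ncard_lt_ncard ⟨Set.inter_subset_left, fun h => lt_irrefl x (h (mem_block_self x)).2⟩
    (FiniteBlocks.finite x)

theorem blockIndex_lt {x y : X} (h : first x = first y) (hxy : x < y) :
    blockIndex x < blockIndex y := by
  have hb := block_eq (first_eq_iff.1 h)
  rw [blockIndex, blockIndex, hb]
  exact Set.ncard_lt_ncard
    ⟨fun z hz => ⟨hz.1, hz.2.trans hxy⟩, fun hs => lt_irrefl x (hs ⟨mem_block_self x, hxy⟩).2⟩
    ((FiniteBlocks.finite x).inter_of_left _)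

theorem eq_of_first_eq_of_blockIndex_eq {x y : X} (h : first x = first y)
    (hi : blockIndex x = blockIndex y) : x = y := by
  rcases lt_trichotomy x y with hl | hl | hl
  · exact absurd hi (blockIndex_lt h hl).ne
  · exact hl
  · exact absurd hi (blockIndex_lt h.symm hl).ne'

theorem blockIndex_lt_iff {x y : X} (h : first x = first y) :
    blockIndex x < blockIndex y ↔ x < y := by
  refine ⟨fun hi => ?_, blockIndex_lt h⟩
  by_contra hn
  rcases (not_lt.1 hn).eq_or_lt with rfl | hl
  · exact lt_irrefl _ hi
  · exact lt_asymm hi (blockIndex_lt h.symm hl)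

theorem first_mono {x y : X} (h : x ≤ y) : first x ≤ first y := by
  by_contra hn
  have h1 : first y < first x := not_le.1 hn
  refine hn (first_eq_iff.2 ?_).le
  have : x ∈ block y :=
    mem_block_of_between (first_mem y) (mem_block_self y) (h1.le.trans (first_le x)) h
  exact mem_block_symm this

/-- Blocks are convex, so the order is lexicographic in these coordinates. -/
theorem lt_iff_first {x y : X} :
    x < y ↔ first x < first y ∨ first x = first y ∧ blockIndex x < blockIndex y := by
  constructor
  · intro h
    rcases (first_mono h.le).eq_or_lt with h1 | h1
    · exact Or.inr ⟨h1, blockIndex_lt h1 h⟩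
    · exact Or.inl h1
  · rintro (h | ⟨h, hi⟩)
    · by_contra hn
      exact h.not_ge (first_mono (not_lt.1 hn))
    · exact (blockIndex_lt_iff h).1 hi

/-- On a block the index is injective with values below the block size, hence takes all these
values. -/
theorem exists_blockIndex_eq {x : X} {i : ℕ} (hi : i < blockSize x) :
    ∃ y, first y = first x ∧ blockIndex y = i := by
  have hfin := FiniteBlocks.finite x
  have himg : hfin.toFinset.image blockIndex = Finset.range (blockSize x) := by
    refine Finset.eq_of_subset_of_card_le ?_ ?_
    · intro j hj
      obtain ⟨y, hy, rfl⟩ := Finset.mem_image.1 hj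
      rw [Finset.mem_range, blockSize_eq (first_eq_iff.2 (hfin.mem_toFinset.1 hy))]
      exact blockIndex_lt_blockSize y
    · rw [Finset.card_range, Finset.card_image_of_injOn, blockSize,
        Set.ncard_eq_toFinset_card _ hfin]
      intro y hy z hz h
      simp only [Set.Finite.coe_toFinset] at hy hz
      exact eq_of_first_eq_of_blockIndex_eq
        ((first_eq_iff.2 hy).symm.trans (first_eq_iff.2 hz)) h
  obtain ⟨y, hy, h⟩ := Finset.mem_image.1 (himg.symm ▸ Finset.mem_range.2 hi)
  exact ⟨y, (first_eq_iff.2 (hfin.mem_toFinset.1 hy)).symm, h⟩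

theorem covBy_iff_first {x y : X} :
    x ⋖ y ↔ first x = first y ∧ blockIndex y = blockIndex x + 1 := by
  constructor
  · intro h
    have hf : first x = first y := first_eq_iff.2 (mem_block_of_covBy h)
    refine ⟨hf, ?_⟩
    have h1 := blockIndex_lt hf h.lt
    by_contra hne
    have h2 := blockIndex_lt_blockSize y
    rw [← blockSize_eq hf] at h2
    obtain ⟨z, hz, hzi⟩ := exists_blockIndex_eq (x := x) (i := blockIndex x + 1) (by omega)
    refine h.2 ((blockIndex_lt_iff hz.symm).1 (by omega)) ?_
    exact (blockIndex_lt_iff (hz.trans hf)).1 (by omega)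
  · rintro ⟨hf, hi⟩
    have hxy : x < y := (blockIndex_lt_iff hf).1 (by omega)
    refine ⟨hxy, fun z h1 h2 => ?_⟩
    have hz : first x = first z := first_eq_iff.2
      (mem_block_of_between (mem_block_self x) (first_eq_iff.1 hf) h1.le h2.le)
    have h3 := blockIndex_lt hz h1
    have h4 := blockIndex_lt (hz.symm.trans hf) h2
    omega

end Blocks

/-! ### The functions s and p in block coordinates -/

section SuccPred

variable {X : Type} [LinearOrder X]

theorem succFn_eq_of_covBy {x y : X} (h : x ⋖ y) : succFn x = y := by
  have hex : ∃ y, x ⋖ y := ⟨y, h⟩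
  rw [succFn, dif_pos hex]
  exact hex.choose_spec.unique_right h

theorem predFn_eq_of_covBy {x y : X} (h : x ⋖ y) : predFn y = x := by
  have hex : ∃ x, x ⋖ y := ⟨x, h⟩
  rw [predFn, dif_pos hex]
  exact hex.choose_spec.unique_left h

theorem succFn_cases (x : X) : x ⋖ succFn x ∨ (∀ y, ¬ x ⋖ y) ∧ succFn x = x := by
  by_cases h : ∃ y, x ⋖ y
  · obtain ⟨y, hy⟩ := h
    exact Or.inl (by rwa [succFn_eq_of_covBy hy])
  · exact Or.inr ⟨fun y hy => h ⟨y, hy⟩, by rw [succFn, dif_neg h]⟩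

theorem predFn_cases (x : X) : predFn x ⋖ x ∨ (∀ y, ¬ y ⋖ x) ∧ predFn x = x := by
  by_cases h : ∃ y, y ⋖ x
  · obtain ⟨y, hy⟩ := h
    exact Or.inl (by rwa [predFn_eq_of_covBy hy])
  · exact Or.inr ⟨fun y hy => h ⟨y, hy⟩, by rw [predFn, dif_neg h]⟩

theorem orderIso_succFn {Y : Type} [LinearOrder Y] (e : X ≃o Y) (x : X) :
    e (succFn x) = succFn (e x) := by
  rcases succFn_cases x with h | ⟨h, h'⟩
  · exact (succFn_eq_of_covBy ((apply_covBy_apply_iff e).2 h)).symm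
  · rcases succFn_cases (e x) with h1 | h1
    · refine (h (e.symm (succFn (e x))) ?_).elim
      rwa [← apply_covBy_apply_iff e, e.apply_symm_apply]
    · rw [h', h1.2]

theorem orderIso_predFn {Y : Type} [LinearOrder Y] (e : X ≃o Y) (x : X) :
    e (predFn x) = predFn (e x) := by
  rcases predFn_cases x with h | ⟨h, h'⟩
  · exact (predFn_eq_of_covBy ((apply_covBy_apply_iff e).2 h)).symm
  · rcases predFn_cases (e x) with h1 | h1
    · refine (h (e.symm (predFn (e x))) ?_).elim
      rwa [← apply_covBy_apply_iff e, e.apply_symm_apply]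
    · rw [h', h1.2]

variable [FiniteBlocks X]

theorem first_succFn (x : X) : first (succFn x) = first x := by
  rcases succFn_cases x with h | h
  · exact (covBy_iff_first.1 h).1.symm
  · rw [h.2]

theorem first_predFn (x : X) : first (predFn x) = first x := by
  rcases predFn_cases x with h | h
  · exact (covBy_iff_first.1 h).1
  · rw [h.2]

theorem blockIndex_succFn (x : X) : blockIndex (succFn x) =
    if blockIndex x + 1 < blockSize x then blockIndex x + 1 else blockIndex x := by
  rcases succFn_cases x with h | ⟨h, h'⟩
  · obtain ⟨h1, h2⟩ := covBy_iff_first.1 h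
    have := blockIndex_lt_blockSize (succFn x)
    rw [← blockSize_eq h1, h2] at this
    rw [if_pos this, h2]
  · rw [if_neg, h']
    intro hlt
    obtain ⟨y, hy, hyi⟩ := exists_blockIndex_eq hlt
    exact h y (covBy_iff_first.2 ⟨hy.symm, hyi⟩)

theorem blockIndex_predFn (x : X) : blockIndex (predFn x) = blockIndex x - 1 := by
  rcases predFn_cases x with h | ⟨h, h'⟩
  · have := (covBy_iff_first.1 h).2
    omega
  · rw [h']
    by_contra hne
    have := blockIndex_lt_blockSize x
    obtain ⟨y, hy, hyi⟩ := exists_blockIndex_eq (x := x) (i := blockIndex x - 1) (by omega)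
    exact h y (covBy_iff_first.2 ⟨hy, by omega⟩)

end SuccPred

/-! ### Extending maps of first points to whole blocks -/

section Transport

variable {X Y : Type} [LinearOrder X] [LinearOrder Y] [FiniteBlocks X] [FiniteBlocks Y]

/-- A map which sends the first points in `A` to first points of blocks of the same size,
preserving the order. -/
structure IsBlockMap (A : Set X) (e : X → Y) : Prop where
  isFirst : ∀ a ∈ A, IsFirst (e a)
  size : ∀ a ∈ A, blockSize (e a) = blockSize a
  lt : ∀ a ∈ A, ∀ b ∈ A, a < b → e a < e b

open Classical in
/-- The extension of a map of first points to the points of their blocks. -/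
noncomputable def transport (e : X → Y) (x : X) : Y :=
  if h : ∃ y, first y = e (first x) ∧ blockIndex y = blockIndex x then h.choose else e (first x)

variable {A : Set X} {e : X → Y}

theorem IsBlockMap.transport_spec (h : IsBlockMap A e) {x : X} (hx : first x ∈ A) :
    first (transport e x) = e (first x) ∧ blockIndex (transport e x) = blockIndex x := by
  have hex : ∃ y, first y = e (first x) ∧ blockIndex y = blockIndex x := by
    have hi := blockIndex_lt_blockSize x
    rw [← blockSize_first, ← h.size _ hx] at hi
    obtain ⟨y, hy, hyi⟩ := exists_blockIndex_eq hi
    exact ⟨y, hy.trans (h.isFirst _ hx).first_eq, hyi⟩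
  rw [transport, dif_pos hex]
  exact hex.choose_spec

/-- Equality of block sizes guarantees a point with the same index in the target block, so the
default value of `transport` is not used. -/
theorem IsBlockMap.transport_lt (h : IsBlockMap A e) {x y : X} (hx : first x ∈ A)
    (hy : first y ∈ A) (hxy : x < y) : transport e x < transport e y := by
  obtain ⟨h1, h2⟩ := h.transport_spec hx
  obtain ⟨h3, h4⟩ := h.transport_spec hy
  rw [lt_iff_first, h1, h2, h3, h4]
  rcases lt_iff_first.1 hxy with h5 | h5
  · exact Or.inl (h.lt _ hx _ hy h5)
  · exact Or.inr ⟨by rw [h5.1], h5.2⟩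

theorem IsBlockMap.blockSize_transport (h : IsBlockMap A e) {x : X} (hx : first x ∈ A) :
    blockSize (transport e x) = blockSize x := by
  rw [← blockSize_first, (h.transport_spec hx).1, h.size _ hx, blockSize_first]

theorem IsBlockMap.transport_succFn (h : IsBlockMap A e) {x : X} (hx : first x ∈ A) :
    transport e (succFn x) = succFn (transport e x) := by
  have hs : first (succFn x) ∈ A := by rwa [first_succFn]
  apply eq_of_first_eq_of_blockIndex_eq
  · rw [(h.transport_spec hs).1, first_succFn, first_succFn, (h.transport_spec hx).1]
  · rw [(h.transport_spec hs).2, blockIndex_succFn, blockIndex_succFn, (h.transport_spec hx).2,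
      h.blockSize_transport hx]

theorem IsBlockMap.transport_predFn (h : IsBlockMap A e) {x : X} (hx : first x ∈ A) :
    transport e (predFn x) = predFn (transport e x) := by
  have hs : first (predFn x) ∈ A := by rwa [first_predFn]
  apply eq_of_first_eq_of_blockIndex_eq
  · rw [(h.transport_spec hs).1, first_predFn, first_predFn, (h.transport_spec hx).1]
  · rw [(h.transport_spec hs).2, blockIndex_predFn, blockIndex_predFn, (h.transport_spec hx).2]

end Transport

/-! ### The ordering of blocks, colored by size -/

section Condensation

/-- The first points of the blocks. -/
abbrev BlockFirst (X : Type) [LinearOrder X] : Type := {x : X // IsFirst x}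

/-- The first points of the blocks are colored by the size of the block. -/
noncomputable def sizeColor (X : Type) [LinearOrder X] (x : BlockFirst X) : ℕ := blockSize x.1

variable {X Y : Type} [LinearOrder X] [LinearOrder Y] [FiniteBlocks X] [FiniteBlocks Y]

theorem exists_orderIso_of_blockFirst (e : BlockFirst X ≃o BlockFirst Y)
    (he : ∀ x, sizeColor Y (e x) = sizeColor X x) : Nonempty (X ≃o Y) := by
  let f : X → Y := fun x => (e ⟨first x, isFirst_first x⟩).1
  have hf : ∀ a : BlockFirst X, f a.1 = (e a).1 := fun a => by
    simp only [f, a.2.first_eq]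
  have h : IsBlockMap {x : X | IsFirst x} f :=
    { isFirst := fun a _ => (e _).2
      size := fun a ha => by
        rw [hf ⟨a, ha⟩]
        exact he ⟨a, ha⟩
      lt := fun a ha b hb hab => by
        rw [hf ⟨a, ha⟩, hf ⟨b, hb⟩]
        exact e.lt_iff_lt.2 hab }
  have hmono : StrictMono (transport f) := fun x y hxy =>
    h.transport_lt (isFirst_first x) (isFirst_first y) hxy
  refine ⟨hmono.orderIsoOfSurjective _ fun y => ?_⟩
  let a := e.symm ⟨first y, isFirst_first y⟩
  have hea : f a.1 = first y := by rw [hf, e.apply_symm_apply]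
  have hi : blockIndex y < blockSize a.1 := by
    rw [← h.size a.1 a.2, hea, blockSize_first]
    exact blockIndex_lt_blockSize y
  obtain ⟨x, hx, hxi⟩ := exists_blockIndex_eq hi
  obtain ⟨h1, h2⟩ := h.transport_spec (isFirst_first x)
  refine ⟨x, eq_of_first_eq_of_blockIndex_eq ?_ (h2.trans hxi)⟩
  rw [h1, hx, a.2.first_eq, hea]

/-- If no block lay between, the interval from `a` to `b` would lie in the finite block of `a`
together with `b`, so the two points would share a block. -/
theorem exists_blockFirst_between {a b : BlockFirst X} (hab : a < b) :
    ∃ c : BlockFirst X, a < c ∧ c < b := by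
  by_contra hn
  push Not at hn
  have hsub : Set.Icc a.1 b.1 ⊆ insert b.1 (block a.1) := by
    intro z hz
    rcases hz.2.eq_or_lt with rfl | hzb
    · exact Set.mem_insert _ _
    refine Set.mem_insert_of_mem _ ?_
    have h1 : a.1 ≤ first z := by
      rw [← a.2.first_eq]
      exact first_mono hz.1
    rcases h1.eq_or_lt with h2 | h2
    · rw [h2]
      exact mem_block_symm (first_mem z)
    · exact absurd (hn ⟨first z, isFirst_first z⟩ h2) (not_le.2 ((first_le z).trans_lt hzb))
  have hb : b.1 ∈ block a.1 := by
    change (Set.uIcc a.1 b.1).Finite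
    rw [Set.uIcc_of_le (show a.1 ≤ b.1 from hab.le)]
    exact ((FiniteBlocks.finite a.1).insert _).subset hsub
  exact absurd hab (not_lt.2 (b.2 _ (mem_block_symm hb)))

end Condensation

/-! ### Counting sp-homogeneous orderings -/

section SpHomogeneous

variable {X : Type} [LinearOrder X]

theorem finiteBlocks_of_encard_le {k : ℕ} (h : ∀ x : X, (block x).encard ≤ k) : FiniteBlocks X :=
  ⟨fun x => Set.finite_of_encard_le_coe (h x)⟩

/-- A size-preserving partial isomorphism of first points extends by `transport` to the substructure
they generate under s and p. The automorphism provided by homogeneity permutes blocks and preserves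
their sizes, hence restricts to first points. -/
theorem sizeColor_homogeneous [FiniteBlocks X] (hX : SpHomogeneous X)
    (F : Finset (BlockFirst X × BlockFirst X))
    (hF : IsPartialIso (sizeColor X) (sizeColor X) F) :
    ∃ g : BlockFirst X → BlockFirst X, StrictMono g ∧
      (∀ x, sizeColor X (g x) = sizeColor X x) ∧ ∀ p ∈ F, g p.1 = p.2 := by
  classical
  let _ : SpLang.Structure X := SpStructure X
  have hw : ∀ x : X, ∃ y, ∀ p ∈ F, p.1.1 = x → p.2.1 = y := fun x => by
    by_cases h : ∃ p ∈ F, p.1.1 = x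
    · obtain ⟨p, hp, rfl⟩ := h
      exact ⟨p.2.1, fun q hq h => congrArg _ ((hF.eq_iff hq hp).1 (Subtype.ext h))⟩
    · exact ⟨x, fun p hp hx => (h ⟨p, hp, hx⟩).elim⟩
  choose w hw using hw
  have hw : ∀ p ∈ F, w p.1.1 = p.2.1 := fun p hp => (hw _ p hp rfl).symm
  let A : Set X := {x | ∃ p ∈ F, p.1.1 = x}
  have hA : A.Finite := by
    refine (F.image fun p => p.1.1).finite_toSet.subset ?_
    rintro x ⟨p, hp, rfl⟩
    exact Finset.mem_coe.2 (Finset.mem_image_of_mem _ hp)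
  have hblock : IsBlockMap A w :=
    { isFirst := by
        rintro _ ⟨p, hp, rfl⟩
        rw [hw p hp]
        exact p.2.2
      size := by
        rintro _ ⟨p, hp, rfl⟩
        rw [hw p hp]
        exact hF.1 p hp
      lt := by
        rintro _ ⟨p, hp, rfl⟩ _ ⟨q, hq, rfl⟩ hlt
        rw [hw p hp, hw q hq]
        exact (hF.2 p hp q hq).1 hlt }
  -- The union of the blocks that start in `A` is closed under s and p, hence contains everything
  -- generated by `A`; `transport w` is well behaved there.
  let T : SpLang.Substructure X :=
    { carrier := {x | first x ∈ A}
      fun_mem := fun f v hv => by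
        cases f with
        | s =>
          change first (succFn (v 0)) ∈ A
          rw [first_succFn]
          exact hv 0
        | p =>
          change first (predFn (v 0)) ∈ A
          rw [first_predFn]
          exact hv 0 }
  let S : SpLang.Substructure X := Language.Substructure.closure SpLang A
  have hS : ∀ x : S, first x.1 ∈ A := fun x => by
    have hle : S ≤ T := Language.Substructure.closure_le.2 fun x hx => by
      change first x ∈ A
      obtain ⟨p, hp, rfl⟩ := hx
      rw [p.1.2.first_eq]
      exact ⟨p, hp, rfl⟩
    exact hle x.2
  have hlt : ∀ x y : S, transport w x.1 < transport w y.1 ↔ x.1 < y.1 := fun x y => by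
    refine ⟨fun h => ?_, hblock.transport_lt (hS x) (hS y)⟩
    rcases lt_trichotomy x.1 y.1 with h1 | h1 | h1
    · exact h1
    · rw [h1] at h
      exact (lt_irrefl _ h).elim
    · exact (lt_asymm h (hblock.transport_lt (hS y) (hS x) h1)).elim
  let f : S ↪[SpLang] X :=
    { toFun := fun x => transport w x.1
      inj' := fun x y h => by
        have h1 := hlt x y
        have h2 := hlt y x
        simp only at h
        rw [h] at h1 h2
        exact Subtype.ext (le_antisymm (not_lt.1 fun hh => lt_irrefl _ (h2.2 hh))
          (not_lt.1 fun hh => lt_irrefl _ (h1.2 hh)))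
      map_fun' := fun f v => by
        cases f with
        | s => exact hblock.transport_succFn (hS (v 0))
        | p => exact hblock.transport_predFn (hS (v 0))
      map_rel' := fun r v => by
        cases r with
        | lt => exact hlt (v 0) (v 1) }
  obtain ⟨g, hg⟩ := hX S (Language.Substructure.fg_closure hA) f
  have hmono : StrictMono g := fun x y hxy =>
    (g.map_rel (LtRel.lt : SpLang.Relations 2) ![x, y]).2 hxy
  let e : X ≃o X := hmono.orderIsoOfSurjective g g.surjective
  refine ⟨fun x => ⟨e x.1, orderIso_isFirst e x.2⟩, fun x y hxy => hmono hxy,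
    fun x => orderIso_blockSize e x.1, fun p hp => Subtype.ext ?_⟩
  have hpA : p.1.1 ∈ A := ⟨p, hp, rfl⟩
  have h1 := DFunLike.congr_fun hg ⟨p.1.1, Language.Substructure.subset_closure hpA⟩
  have h2 : transport w p.1.1 = g p.1.1 := h1
  change g p.1.1 = p.2.1
  have hfirst := p.1.2.first_eq
  have h3 := (hblock.transport_spec (hfirst.symm ▸ hpA)).1
  have h4 := (hblock.transport_spec (hfirst.symm ▸ hpA)).2
  rw [← h2, ← hw p hp]
  rw [hfirst] at h3
  have hwf : IsFirst (w p.1.1) := hblock.isFirst _ hpA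
  refine eq_of_first_eq_of_blockIndex_eq (h3.trans hwf.first_eq.symm) ?_
  have hzero : ∀ x : X, IsFirst x → blockIndex x = 0 := fun x hx => by
    have : block x ∩ Set.Iio x = ∅ := Set.eq_empty_of_forall_notMem fun y hy =>
      not_lt.2 (hx y hy.1) hy.2
    rw [blockIndex, this, Set.ncard_empty]
  rw [h4, hzero _ p.1.2, hzero _ hwf]

theorem SpHomogeneous.isSaturated [FiniteBlocks X] (hX : SpHomogeneous X) :
    IsSaturated (sizeColor X) :=
  IsSaturated.of_homogeneous (sizeColor_homogeneous hX)

theorem sizeColor_mem_Icc {k : ℕ} (h : ∀ x : X, (block x).encard ≤ k) (x : BlockFirst X) :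
    sizeColor X x ∈ Finset.Icc 1 k := by
  have := finiteBlocks_of_encard_le h
  refine Finset.mem_Icc.2 ⟨blockSize_pos x.1, ?_⟩
  have h1 := h x.1
  rw [← (FiniteBlocks.finite x.1).cast_ncard_eq] at h1
  exact_mod_cast h1

/-- Transitivity comes from saturation: a pair witnessing the second relation can be moved to start
at the end of the first. Interpolation comes from `exists_blockFirst_between`. -/
theorem colorInvariant_sizeColor_mem {k : ℕ} (hX : SpHomogeneous X)
    (h : ∀ x : X, (block x).encard ≤ k) :
    colorInvariant (Finset.Icc 1 k) (sizeColor X) ∈ (Finset.Icc 1 k).powerset.biUnion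
      fun U => (denseArrangements U).image fun R => (U, R) := by
  classical
  have := finiteBlocks_of_encard_le h
  have hsat := hX.isSaturated
  have hcol := sizeColor_mem_Icc h
  have hmem : ∀ a b, (a, b) ∈ (colorInvariant (Finset.Icc 1 k) (sizeColor X)).2 ↔
      ColorBefore (sizeColor X) a b := fun a b => by
    simp only [colorInvariant, Finset.mem_filter, Finset.mem_product, and_iff_right_iff_imp]
    rintro ⟨x, y, -, rfl, rfl⟩
    exact ⟨hcol x, hcol y⟩
  have hmem' : ∀ a, a ∈ (colorInvariant (Finset.Icc 1 k) (sizeColor X)).1 ↔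
      ∃ x, sizeColor X x = a := fun a => by
    simp only [colorInvariant, Finset.mem_filter, and_iff_right_iff_imp]
    rintro ⟨x, rfl⟩
    exact hcol x
  refine Finset.mem_biUnion.2 ⟨_, Finset.mem_powerset.2 (Finset.filter_subset _ _),
    Finset.mem_image.2 ⟨_, mem_denseArrangements.2 ⟨⟨?_, ?_, ?_, ?_⟩, ?_⟩, rfl⟩⟩
  · intro a b hab
    obtain ⟨x, y, -, rfl, rfl⟩ := (hmem _ _).1 hab
    exact (hmem' _).2 ⟨x, rfl⟩
  · intro a b hab
    obtain ⟨x, y, -, rfl, rfl⟩ := (hmem _ _).1 hab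
    exact (hmem' _).2 ⟨y, rfl⟩
  · intro a b c hab hbc
    obtain ⟨x, y, hxy, rfl, rfl⟩ := (hmem _ _).1 hab
    obtain ⟨z, hyz, hz⟩ := hsat.above y c ((hmem _ _).1 hbc)
    exact (hmem _ _).2 ⟨x, z, hxy.trans hyz, rfl, hz⟩
  · intro a ha b hb hne
    obtain ⟨x, rfl⟩ := (hmem' _).1 ha
    obtain ⟨y, rfl⟩ := (hmem' _).1 hb
    rcases lt_trichotomy x y with hl | hl | hl
    · exact Or.inl ((hmem _ _).2 ⟨x, y, hl, rfl, rfl⟩)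
    · exact (hne (hl ▸ rfl)).elim
    · exact Or.inr ((hmem _ _).2 ⟨y, x, hl, rfl, rfl⟩)
  · intro a b hab
    obtain ⟨x, y, hxy, rfl, rfl⟩ := (hmem _ _).1 hab
    obtain ⟨z, h1, h2⟩ := exists_blockFirst_between hxy
    exact ⟨sizeColor X z, (hmem _ _).2 ⟨x, z, h1, rfl, rfl⟩, (hmem _ _).2 ⟨z, y, h2, rfl, rfl⟩⟩

theorem spHomTypes_finite_and_numSp_le (k : ℕ) :
    (spHomTypes k).Finite ∧ (numSp k : ℝ) ≤ 5 / 2 * ((k ! : ℝ) * 2 ^ k) := by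
  have h := quotient_image_finite_and_ncard_le
    {X : LinOrd.{0} | Countable X ∧ SpHomogeneous X ∧ ∀ x : X, (block x).encard ≤ k}
    (fun X => colorInvariant (Finset.Icc 1 k) (sizeColor X))
    ((Finset.Icc 1 k).powerset.biUnion fun U => (denseArrangements U).image fun R => (U, R))
    (fun X hX => colorInvariant_sizeColor_mem hX.2.1 hX.2.2) (fun X hX Y hY h => by
      have := hX.1
      have := hY.1
      have := finiteBlocks_of_encard_le hX.2.2
      have := finiteBlocks_of_encard_le hY.2.2
      obtain ⟨e, he⟩ := (SpHomogeneous.isSaturated hX.2.1).exists_orderIso_of_colorInvariant_eq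
        (SpHomogeneous.isSaturated hY.2.1) (sizeColor_mem_Icc hX.2.2) (sizeColor_mem_Icc hY.2.2) h
      exact exists_orderIso_of_blockFirst e he)
  refine ⟨h.1, ?_⟩
  have h1 : numSp k ≤ ∑ U ∈ (Finset.Icc 1 k).powerset, (denseArrangements U).card :=
    h.2.trans (Finset.card_biUnion_le.trans (Finset.sum_le_sum fun U _ => Finset.card_image_le))
  have h2 := sum_card_denseArrangements_le (Finset.Icc 1 k)
  rw [Nat.card_Icc, Nat.add_sub_cancel] at h2
  refine le_trans ?_ h2
  exact_mod_cast h1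

end SpHomogeneous

/-! ### C_{n,m}-homogeneous orderings are sp-homogeneous with bounded blocks -/

section CHomogeneous

theorem le_encard_of_injective {α : Type*} {d : ℕ} {s : Set α} (g : Fin d → α)
    (hg : Function.Injective g)
    (hs : ∀ i, g i ∈ s) : (d : ℕ∞) ≤ s.encard := by
  have h1 : Set.range g ⊆ s := Set.range_subset_iff.2 hs
  have h2 := Set.encard_le_encard h1
  rw [← Set.image_univ, hg.encard_image, Set.encard_univ, ENat.card_eq_coe_fintype_card,
    Fintype.card_fin] at h2
  exact h2

variable {X : Type} [LinearOrder X]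

theorem mem_succs {x y : X} : y ∈ succs x ↔ x < y ∧ y ∈ block x := transGen_covBy_iff

theorem mem_preds {x y : X} : y ∈ preds x ↔ y < x ∧ y ∈ block x :=
  transGen_covBy_iff.trans (and_congr_right fun _ => ⟨mem_block_symm, mem_block_symm⟩)

theorem adj_comm {l : ℕ} {x y : X} : Adj l x y ↔ Adj l y x := by
  rw [Adj, Adj, ne_comm, min_comm, max_comm]

theorem adj_of_lt {l : ℕ} {x y : X} (h : x < y) : Adj l x y ↔ (Set.Ioo x y).encard = l := by
  rw [Adj, min_eq_left h.le, max_eq_right h.le]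
  exact and_iff_right h.ne

theorem not_adj_self {l : ℕ} {x : X} : ¬ Adj l x x := fun h => h.1 rfl

instance (n m : ℕ) : (CLang n m).IsRelational := fun _ => inferInstanceAs (IsEmpty Empty)

theorem CHomogeneous.exists_orderIso {n m : ℕ} (hX : CHomogeneous n m X) {A : Set X}
    (hA : A.Finite) (w : X → X) (hlt : ∀ a ∈ A, ∀ b ∈ A, a < b → w a < w b)
    (hS : ∀ a ∈ A, ∀ i < n, HasSuccs i (w a) ↔ HasSuccs i a)
    (hP : ∀ a ∈ A, ∀ i < m, HasPreds i (w a) ↔ HasPreds i a)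
    (hAdj : ∀ a ∈ A, ∀ b ∈ A, a < b → ∀ l < n + m, Adj l (w a) (w b) ↔ Adj l a b) :
    ∃ g : X ≃o X, ∀ a ∈ A, g a = w a := by
  let _ : (CLang n m).Structure X := CStructure n m X
  let S : (CLang n m).Substructure X := Language.Substructure.closure (CLang n m) A
  have hmem : ∀ x : S, x.1 ∈ A := fun x =>
    (Language.Substructure.mem_closure_iff_of_isRelational (CLang n m) _ _).1 x.2
  have hmono : StrictMono fun x : S => w x.1 := fun x y h => hlt _ (hmem x) _ (hmem y) h
  let f : S ↪[CLang n m] X :=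
    { toFun := fun x => w x.1
      inj' := hmono.injective
      map_fun' := fun f => Empty.elim f
      map_rel' := fun r v => by
        cases r with
        | lt => exact hmono.lt_iff_lt
        | S i => exact hS _ (hmem (v 0)) i i.2
        | P i => exact hP _ (hmem (v 0)) i i.2
        | Adj l =>
          change Adj l (w (v 0).1) (w (v 1).1) ↔ Adj l (v 0).1 (v 1).1
          rcases lt_trichotomy (v 0).1 (v 1).1 with h | h | h
          · exact hAdj _ (hmem (v 0)) _ (hmem (v 1)) h l l.2
          · rw [h]
            exact iff_of_false not_adj_self not_adj_self
          · rw [adj_comm, hAdj _ (hmem (v 1)) _ (hmem (v 0)) h l l.2, adj_comm] }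
  obtain ⟨g, hg⟩ := hX S (Language.Substructure.fg_closure hA) f
  have hgmono : StrictMono g := fun x y hxy =>
    (g.map_rel (CRel.lt : (CLang n m).Relations 2) ![x, y]).2 hxy
  refine ⟨hgmono.orderIsoOfSurjective g g.surjective, fun a ha => ?_⟩
  exact (DFunLike.congr_fun hg ⟨a, Language.Substructure.subset_closure ha⟩).symm

theorem not_hasSuccs {n i : ℕ} {x : X} (h : (n : ℕ∞) ≤ (succs x).encard) (hi : i < n) :
    ¬ HasSuccs i x := fun h' => by
  rw [h'] at h
  exact absurd hi (not_lt.2 (by exact_mod_cast h))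

theorem not_hasPreds {n i : ℕ} {x : X} (h : (n : ℕ∞) ≤ (preds x).encard) (hi : i < n) :
    ¬ HasPreds i x := fun h' => by
  rw [h'] at h
  exact absurd hi (not_lt.2 (by exact_mod_cast h))

/-- No automorphism moves a point to its immediate successor if the point has sufficiently many
successors and predecessors. -/
theorem CHomogeneous.false_of_shift {n m : ℕ} (hX : CHomogeneous n m X) (g : X ≃o X) {x : X}
    (hg : x ⋖ g x) (hx : (m : ℕ∞) ≤ (preds x).encard) : False := by
  have hcov : ∀ j, g^[j] x ⋖ g^[j + 1] x := fun j => by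
    induction j with
    | zero => exact hg
    | succ j ih =>
      rw [Function.iterate_succ_apply', Function.iterate_succ_apply' _ (j + 1)]
      exact (apply_covBy_apply_iff g).2 ih
  obtain ⟨a, ha⟩ : ∃ a : ℕ → X, a = fun j => g^[j] x := ⟨_, rfl⟩
  have hcov : ∀ j, a j ⋖ a (j + 1) := fun j => by
    rw [ha]
    exact hcov j
  have ha0 : a 0 = x := by rw [ha]; rfl
  have hmono : StrictMono a := strictMono_nat_of_lt_succ fun j => (hcov j).lt
  have hblock : ∀ j, a j ∈ block x := fun j => by
    induction j with
    | zero => rw [ha0]; exact mem_block_self x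
    | succ j ih => exact mem_block_trans ih (mem_block_of_covBy (hcov j))
  have hblock' : ∀ i j, a j ∈ block (a i) := fun i j =>
    mem_block_trans (mem_block_symm (hblock i)) (hblock j)
  have hpred : ∀ j, (m : ℕ∞) ≤ (preds (a j)).encard := fun j => by
    refine hx.trans (Set.encard_le_encard fun z hz => ?_)
    rw [mem_preds] at hz ⊢
    refine ⟨hz.1.trans_le ?_, mem_block_trans (mem_block_symm (hblock j)) hz.2⟩
    rw [← ha0]
    exact hmono.monotone (Nat.zero_le j)
  -- The iterates of `x` under `g` form an infinite ascending chain of immediate successors, so only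
  -- predecessors had to be assumed.
  have hsucc : ∀ j, (n : ℕ∞) ≤ (succs (a j)).encard := fun j =>
    le_encard_of_injective (fun i : Fin n => a (j + 1 + i))
      (fun i i' h => Fin.ext (by have := hmono.injective h; omega))
      fun i => mem_succs.2 ⟨hmono (by omega), hblock' _ _⟩
  have hIoo : ∀ d, n + m < d → ((n + m : ℕ) : ℕ∞) ≤ (Set.Ioo (a 0) (a d)).encard := fun d hd =>
    le_encard_of_injective (fun i : Fin (n + m) => a (i + 1))
      (fun i i' h => Fin.ext (by have := hmono.injective h; omega))
      fun i => ⟨hmono (by omega), hmono (by omega)⟩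
  have hadj : ∀ d, n + m < d → ∀ l < n + m, ¬ Adj l (a 0) (a d) := fun d hd l hl h => by
    have h1 := hIoo d hd
    rw [(adj_of_lt (hmono (by omega))).1 h] at h1
    exact absurd hl (not_lt.2 (by exact_mod_cast h1))
  classical
  -- From this distance on, at least n+m points lie strictly between and no available `Adj` relation
  -- holds. Hence fixing `a 0` and moving `a D` to `a (D + 1)` is a partial isomorphism.
  let D := n + m + 1
  let w : X → X := fun z => if z = a D then a (D + 1) else z
  have hw0 : w (a 0) = a 0 := if_neg (hmono (show 0 < D by omega)).ne
  have hwD : w (a D) = a (D + 1) := if_pos rfl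
  obtain ⟨h, hh⟩ := hX.exists_orderIso (A := {a 0, a D}) (Set.toFinite _) w
    (by
      rintro b (rfl | rfl) c (rfl | rfl) hbc
      · exact (lt_irrefl _ hbc).elim
      · rw [hw0, hwD]
        exact hmono (by omega)
      · exact (lt_asymm hbc (hmono (show 0 < D by omega))).elim
      · exact (lt_irrefl _ hbc).elim)
    (by
      rintro b (rfl | rfl) i hi
      · rw [hw0]
      · rw [hwD]
        exact iff_of_false (not_hasSuccs (hsucc _) hi) (not_hasSuccs (hsucc _) hi))
    (by
      rintro b (rfl | rfl) i hi
      · rw [hw0]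
      · rw [hwD]
        exact iff_of_false (not_hasPreds (hpred _) hi) (not_hasPreds (hpred _) hi))
    (by
      rintro b (rfl | rfl) c (rfl | rfl) hbc l hl
      · exact (lt_irrefl _ hbc).elim
      · rw [hw0, hwD]
        exact iff_of_false (hadj _ (by omega) l hl) (hadj _ (by omega) l hl)
      · exact (lt_asymm hbc (hmono (show 0 < D by omega))).elim
      · exact (lt_irrefl _ hbc).elim)
  have h0 : h (a 0) = a 0 := (hh _ (Set.mem_insert _ _)).trans hw0
  have hD : h (a D) = a (D + 1) := (hh _ (Set.mem_insert_of_mem _ rfl)).trans hwD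
  -- The extension `h` would map a finite interval onto a strictly larger finite interval.
  have himg := h.image_Ioo (a 0) (a D)
  rw [h0, hD] at himg
  have hfin : (Set.Ioo (a 0) (a (D + 1))).Finite := by
    refine Set.Finite.subset (hblock' 0 (D + 1)) ?_
    rw [Set.uIcc_of_le (hmono.monotone (Nat.zero_le _))]
    exact Set.Ioo_subset_Icc_self
  have hss : Set.Ioo (a 0) (a D) ⊂ Set.Ioo (a 0) (a (D + 1)) :=
    ⟨Set.Ioo_subset_Ioo_right (hcov D).le, fun hs =>
      lt_irrefl (a D) (hs ⟨hmono (show 0 < D by omega), (hcov D).lt⟩).2⟩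
  have hlt := Set.ncard_lt_ncard hss hfin
  rw [← himg, Set.ncard_image_of_injective _ h.injective] at hlt
  exact lt_irrefl _ hlt

/-- In a larger block some point and its immediate successor both have at least m predecessors and n
successors, so no `S_i` or `P_j` of the language separates them. An automorphism would move one to
the other, contrary to `CHomogeneous.false_of_shift`. -/
theorem CHomogeneous.encard_block_le {n m : ℕ} (hX : CHomogeneous n m X) (x : X) :
    (block x).encard ≤ (n + m + 1 : ℕ) := by
  by_contra hn
  have hcard : ((n + m + 2 : ℕ) : ℕ∞) ≤ (block x).encard := by
    have := Order.add_one_le_of_lt (not_le.1 hn)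
    exact_mod_cast this
  obtain ⟨t, ht, htc⟩ := Set.exists_subset_encard_eq hcard
  have htf : t.Finite := Set.finite_of_encard_eq_coe htc
  obtain ⟨F, rfl⟩ := htf.exists_finset_coe
  rw [Set.encard_coe_eq_coe_finsetCard] at htc
  let f := F.orderEmbOfFin (by exact_mod_cast htc : F.card = n + m + 2)
  have hf : ∀ i, f i ∈ block x := fun i => ht (Finset.orderEmbOfFin_mem F _ i)
  have hff : ∀ i j, f j ∈ block (f i) := fun i j =>
    mem_block_trans (mem_block_symm (hf i)) (hf j)
  let a := f ⟨m, by omega⟩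
  let b := f ⟨m + 1, by omega⟩
  have hab : a < b := f.strictMono (Fin.mk_lt_mk.2 (Nat.lt_succ_self m))
  -- The chosen n+m+2 points need not be consecutive in the block, so the immediate successor of `a`
  -- is some `c ≤ b`; it inherits the n successors of `b`.
  obtain ⟨c, hac, hcb⟩ := exists_covBy_le hab (hff _ _)
  have hca : c ∈ block a := mem_block_of_covBy hac
  have hpa : (m : ℕ∞) ≤ (preds a).encard :=
    le_encard_of_injective (fun i : Fin m => f ⟨i, by omega⟩)
      (fun i i' h => Fin.ext (Fin.mk.inj_iff.1 (f.injective h)))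
      fun i => mem_preds.2 ⟨f.strictMono (Fin.mk_lt_mk.2 i.2), hff _ _⟩
  have hsb : (n : ℕ∞) ≤ (succs b).encard :=
    le_encard_of_injective (fun i : Fin n => f ⟨m + 2 + i, by omega⟩)
      (fun i i' h => Fin.ext (by have := Fin.mk.inj_iff.1 (f.injective h); omega))
      fun i => mem_succs.2 ⟨f.strictMono (Fin.mk_lt_mk.2 (by omega)), hff _ _⟩
  have hsc : (n : ℕ∞) ≤ (succs c).encard := hsb.trans (Set.encard_le_encard fun z hz => by
    rw [mem_succs] at hz ⊢
    exact ⟨hcb.trans_lt hz.1, mem_block_trans (mem_block_symm hca)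
      (mem_block_trans (hff _ _) hz.2)⟩)
  have hsa : (n : ℕ∞) ≤ (succs a).encard := hsc.trans (Set.encard_le_encard fun z hz => by
    rw [mem_succs] at hz ⊢
    exact ⟨hac.lt.trans hz.1, mem_block_trans hca hz.2⟩)
  have hpc : (m : ℕ∞) ≤ (preds c).encard := hpa.trans (Set.encard_le_encard fun z hz => by
    rw [mem_preds] at hz ⊢
    exact ⟨hz.1.trans hac.lt, mem_block_trans (mem_block_symm hca) hz.2⟩)
  obtain ⟨g, hg⟩ := hX.exists_orderIso (A := {a}) (Set.toFinite _) (fun _ => c)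
    (by
      rintro _ rfl _ rfl h
      exact (lt_irrefl _ h).elim)
    (by
      rintro _ rfl i hi
      exact iff_of_false (not_hasSuccs hsc hi) (not_hasSuccs hsa hi))
    (by
      rintro _ rfl i hi
      exact iff_of_false (not_hasPreds hpc hi) (not_hasPreds hpa hi))
    (by
      rintro _ rfl _ rfl h
      exact (lt_irrefl _ h).elim)
  have hga : g a = c := hg a rfl
  exact hX.false_of_shift g (hga.symm ▸ hac) hpa

theorem mem_of_mem_succs {B : Set X} (hB : ∀ x ∈ B, succFn x ∈ B) {x y : X} (hx : x ∈ B)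
    (h : y ∈ succs x) : y ∈ B := by
  change Relation.TransGen (· ⋖ ·) x y at h
  induction h with
  | single h => exact succFn_eq_of_covBy h ▸ hB _ hx
  | tail _ h ih => exact succFn_eq_of_covBy h ▸ hB _ ih

theorem mem_of_mem_preds {B : Set X} (hB : ∀ x ∈ B, predFn x ∈ B) {x y : X} (hx : x ∈ B)
    (h : y ∈ preds x) : y ∈ B := by
  change Relation.TransGen (· ⋖ ·) y x at h
  induction h using Relation.TransGen.head_induction_on with
  | single h => exact predFn_eq_of_covBy h ▸ hB _ hx
  | head h _ ih => exact predFn_eq_of_covBy h ▸ hB _ ih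

/-- This form is visibly preserved by embeddings for <, s and p. The condition `x < y` excludes j =
0 and the iterates that stay at a point without successor. -/
theorem mem_succs_iff_iterate {x y : X} : y ∈ succs x ↔ x < y ∧ ∃ j, succFn^[j] x = y := by
  constructor
  · intro h
    exact ⟨(mem_succs.1 h).1, mem_of_mem_succs (B := {y | ∃ j, succFn^[j] x = y})
      (by
        rintro _ ⟨j, rfl⟩
        exact ⟨j + 1, Function.iterate_succ_apply' _ _ _⟩) ⟨0, rfl⟩ h⟩
  · rintro ⟨h, j, rfl⟩
    refine mem_succs.2 ⟨h, ?_⟩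
    clear h
    induction j with
    | zero => exact mem_block_self x
    | succ j ih =>
      rw [Function.iterate_succ_apply']
      rcases succFn_cases (succFn^[j] x) with h | h
      · exact mem_block_trans ih (mem_block_of_covBy h)
      · rwa [h.2]

theorem mem_succs_of_Ioo_finite {x y : X} (hxy : x < y) (h : (Set.Ioo x y).Finite) :
    y ∈ succs x := by
  refine mem_succs.2 ⟨hxy, ?_⟩
  change (Set.uIcc x y).Finite
  rw [Set.uIcc_of_le hxy.le, ← Set.Ioo_union_both hxy.le]
  exact h.union (Set.toFinite _)

/-- As blocks are finite, a finitely generated s,p-substructure is finite. It contains all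
successors and predecessors of its points, and so does its image. Hence the embedding preserves the
`S_i`, `P_j` and `Adj_l`, and C_{n,m}-homogeneity extends it. -/
theorem CHomogeneous.spHomogeneous {n m : ℕ} (hX : CHomogeneous n m X) : SpHomogeneous X := by
  classical
  have hfb : FiniteBlocks X := finiteBlocks_of_encard_le hX.encard_block_le
  let _ : SpLang.Structure X := SpStructure X
  intro S hS f
  have hSs : ∀ x ∈ (S : Set X), succFn x ∈ (S : Set X) := fun x hx =>
    S.fun_mem SpFunc.s ![x] fun _ => by simpa using hx
  have hSp : ∀ x ∈ (S : Set X), predFn x ∈ (S : Set X) := fun x hx =>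
    S.fun_mem SpFunc.p ![x] fun _ => by simpa using hx
  have hfs : ∀ x : S, f ⟨succFn x.1, hSs _ x.2⟩ = succFn (f x) := fun x =>
    f.map_fun (SpFunc.s : SpLang.Functions 1) ![x]
  have hfp : ∀ x : S, f ⟨predFn x.1, hSp _ x.2⟩ = predFn (f x) := fun x =>
    f.map_fun (SpFunc.p : SpLang.Functions 1) ![x]
  have hlt : ∀ x y : S, f x < f y ↔ x.1 < y.1 := fun x y =>
    f.map_rel (LtRel.lt : SpLang.Relations 2) ![x, y]
  have hRs : ∀ x ∈ Set.range f, succFn x ∈ Set.range f := by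
    rintro _ ⟨x, rfl⟩
    exact ⟨_, hfs x⟩
  have hRp : ∀ x ∈ Set.range f, predFn x ∈ Set.range f := by
    rintro _ ⟨x, rfl⟩
    exact ⟨_, hfp x⟩
  have hiter : ∀ (x : S) (j : ℕ), ∃ y : S, y.1 = succFn^[j] x.1 ∧ f y = succFn^[j] (f x) :=
    fun x j => by
      induction j with
      | zero => exact ⟨x, rfl, rfl⟩
      | succ j ih =>
        obtain ⟨y, h1, h2⟩ := ih
        refine ⟨⟨succFn y.1, hSs _ y.2⟩, ?_, ?_⟩
        · rw [Function.iterate_succ_apply', ← h1]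
        · rw [Function.iterate_succ_apply', ← h2, hfs]
  have hsucc : ∀ x y : S, f y ∈ succs (f x) ↔ y.1 ∈ succs x.1 := fun x y => by
    rw [mem_succs_iff_iterate, mem_succs_iff_iterate, hlt]
    refine and_congr_right fun _ => exists_congr fun j => ?_
    obtain ⟨z, h1, h2⟩ := hiter x j
    rw [← h1, ← h2, f.injective.eq_iff]
    exact Subtype.ext_iff
  have hpred : ∀ x y : S, f y ∈ preds (f x) ↔ y.1 ∈ preds x.1 := fun x y => hsucc y x
  have hcard : ∀ {s t : Set X}, s ⊆ S → t ⊆ Set.range f → (∀ y : S, f y ∈ t ↔ y.1 ∈ s) →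
      t.encard = s.encard := fun {s t} hs ht h => by
    have h1 : s = Subtype.val '' {y : S | y.1 ∈ s} := by
      ext z
      exact ⟨fun hz => ⟨⟨z, hs hz⟩, hz, rfl⟩, by rintro ⟨y, hy, rfl⟩; exact hy⟩
    have h2 : t = f '' {y : S | y.1 ∈ s} := by
      ext z
      constructor
      · intro hz
        obtain ⟨y, rfl⟩ := ht hz
        exact ⟨y, (h y).1 hz, rfl⟩
      · rintro ⟨y, hy, rfl⟩
        exact (h y).2 hy
    rw [h1, h2, f.injective.encard_image, Subtype.val_injective.encard_image]
  -- Within one block the interval lies in `S` and its image interval in the range of `f`. Between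
  -- different blocks both intervals are infinite, so neither has cardinality l.
  have hIoo : ∀ (x y : S), x.1 < y.1 → ∀ l : ℕ,
      (Set.Ioo (f x) (f y)).encard = l ↔ (Set.Ioo x.1 y.1).encard = l := fun x y hxy l => by
    by_cases h : y.1 ∈ succs x.1
    · have h' := (hsucc x y).2 h
      rw [hcard (s := Set.Ioo x.1 y.1) (t := Set.Ioo (f x) (f y))]
      · intro z hz
        exact mem_of_mem_succs hSs x.2 (mem_succs.2 ⟨hz.1, mem_block_of_between
          (mem_block_self _) (mem_succs.1 h).2 hz.1.le hz.2.le⟩)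
      · intro z hz
        exact mem_of_mem_succs hRs ⟨x, rfl⟩ (mem_succs.2 ⟨hz.1, mem_block_of_between
          (mem_block_self _) (mem_succs.1 h').2 hz.1.le hz.2.le⟩)
      · intro z
        exact and_congr (hlt x z) (hlt z y)
    · refine iff_of_false (fun hl => h ?_) (fun hl => h ?_)
      · exact (hsucc x y).1
          (mem_succs_of_Ioo_finite ((hlt x y).2 hxy) (Set.finite_of_encard_eq_coe hl))
      · exact mem_succs_of_Ioo_finite hxy (Set.finite_of_encard_eq_coe hl)
  have hfin : (S : Set X).Finite := by
    obtain ⟨t, ht⟩ := hS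
    let T : SpLang.Substructure X :=
      { carrier := {x | first x ∈ first '' (t : Set X)}
        fun_mem := fun f v hv => by
          cases f with
          | s =>
            change first (succFn (v 0)) ∈ first '' (t : Set X)
            rw [first_succFn]
            exact hv 0
          | p =>
            change first (predFn (v 0)) ∈ first '' (t : Set X)
            rw [first_predFn]
            exact hv 0 }
    have hle : S ≤ T := by
      rw [← ht]
      exact Language.Substructure.closure_le.2 fun x hx => ⟨x, hx, rfl⟩
    refine Set.Finite.subset (t.finite_toSet.biUnion fun x _ => FiniteBlocks.finite x)
      fun z hz => ?_
    obtain ⟨x, hx, hxz⟩ := hle hz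
    exact Set.mem_biUnion hx (first_eq_iff.1 hxz)
  let w : X → X := fun x => if h : x ∈ S then f ⟨x, h⟩ else x
  have hw : ∀ a (ha : a ∈ S), w a = f ⟨a, ha⟩ := fun a ha => dif_pos ha
  obtain ⟨g, hg⟩ := hX.exists_orderIso hfin w
    (by
      intro a ha b hb hab
      rw [hw a ha, hw b hb]
      exact (hlt _ _).2 hab)
    (by
      intro a ha i _
      rw [hw a ha, HasSuccs, HasSuccs, hcard (s := succs a)
        (fun z hz => mem_of_mem_succs hSs ha hz)
        (fun z hz => mem_of_mem_succs hRs ⟨_, rfl⟩ hz) (hsucc ⟨a, ha⟩)])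
    (by
      intro a ha i _
      rw [hw a ha, HasPreds, HasPreds, hcard (s := preds a)
        (fun z hz => mem_of_mem_preds hSp ha hz)
        (fun z hz => mem_of_mem_preds hRp ⟨_, rfl⟩ hz) (hpred ⟨a, ha⟩)])
    (by
      intro a ha b hb hab l _
      rw [hw a ha, hw b hb, adj_of_lt hab, adj_of_lt ((hlt ⟨a, ha⟩ ⟨b, hb⟩).2 hab)]
      exact hIoo _ _ hab l)
  refine ⟨{ g.toEquiv with
      map_fun' := fun f v => by
        cases f with
        | s => exact orderIso_succFn g (v 0)
        | p => exact orderIso_predFn g (v 0)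
      map_rel' := fun r v => by
        cases r with
        | lt => exact g.lt_iff_lt }, ?_⟩
  ext x
  exact ((hg x.1 x.2).trans (hw x.1 x.2)).symm

theorem cHomTypes_subset_spHomTypes (n m : ℕ) : cHomTypes n m ⊆ spHomTypes (n + m + 1) := by
  rintro _ ⟨X, ⟨h1, h2⟩, rfl⟩
  exact ⟨X, ⟨h1, h2.spHomogeneous, h2.encard_block_le⟩, rfl⟩

theorem numC_le_numSp (n m : ℕ) : numC n m ≤ numSp (n + m + 1) :=
  Set.ncard_le_ncard (cHomTypes_subset_spHomTypes n m) (spHomTypes_finite_and_numSp_le _).1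

/-- The constants are 11/4 = (5/2)/(10/11) and 10/11 = 2/(11/5). -/
theorem numSp_div_numColored_le (k : ℕ) :
    (numSp k : ℝ) / numColored k ≤ 11 / 4 * (10 / 11) ^ k := by
  have h1 := (spHomTypes_finite_and_numSp_le k).2
  have h2 := le_numColored k
  have h3 : 0 < (k ! : ℝ) * (11 / 5) ^ k := by positivity
  rw [div_le_iff₀ (by linarith)]
  have h4 : 0 ≤ 11 / 4 * (10 / 11 : ℝ) ^ k := by positivity
  have h5 : (2 : ℝ) ^ k = (10 / 11) ^ k * (11 / 5) ^ k := by
    rw [← mul_pow]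
    norm_num
  calc (numSp k : ℝ) ≤ 5 / 2 * ((k ! : ℝ) * 2 ^ k) := h1
    _ = 11 / 4 * (10 / 11) ^ k * (10 / 11 * ((k ! : ℝ) * (11 / 5) ^ k)) := by
      rw [h5]
      ring
    _ ≤ 11 / 4 * (10 / 11) ^ k * numColored k := mul_le_mul_of_nonneg_left h2 h4

theorem tendsto_numSp_div_numColored :
    Tendsto (fun k : ℕ => (numSp k : ℝ) / (numColored k : ℝ)) atTop (𝓝 0) := by
  refine squeeze_zero (fun k => by positivity) numSp_div_numColored_le ?_
  have := (tendsto_pow_atTop_nhds_zero_of_lt_one (r := (10 / 11 : ℝ)) (by norm_num)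
    (by norm_num)).const_mul (11 / 4)
  simpa using this

theorem numSp_le (k : ℕ) : (numSp k : ℝ) ≤ 5 / 2 * ((k ! : ℝ) * (2.123 : ℝ) ^ k) := by
  refine (spHomTypes_finite_and_numSp_le k).2.trans ?_
  have : (2 : ℝ) ^ k ≤ 2.123 ^ k := pow_le_pow_left₀ (by norm_num) (by norm_num) k
  gcongr

end CHomogeneous

end LinHom

theorem mainTheorem8 :
    ((∀ n m : ℕ, (LinHom.cHomTypes n m).Finite) ∧
      (∀ k : ℕ, (LinHom.spHomTypes k).Finite) ∧
      (∀ k : ℕ, (LinHom.colorHomTypes k).Finite)) ∧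
    (∃ C : ℝ, ∀ n m k : ℕ, k = n + m + 1 →
      (LinHom.numC n m : ℝ) ≤ C * ((k ! : ℝ) * (2.123 : ℝ) ^ k)) ∧
    (∀ ε : ℝ, 0 < ε → ∃ K : ℕ, ∀ n m k : ℕ, k = n + m + 1 → K ≤ k →
      (LinHom.numC n m : ℝ) / (LinHom.numColored k : ℝ) < ε) ∧
    ((fun k : ℕ => (LinHom.numSp k : ℝ)) =O[atTop]
      (fun k : ℕ => (k ! : ℝ) * (2.123 : ℝ) ^ k)) ∧
    Tendsto (fun k : ℕ => (LinHom.numSp k : ℝ) / (LinHom.numColored k : ℝ)) atTop (𝓝 0) := by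
  refine ⟨⟨fun n m => ?_, fun k => (LinHom.spHomTypes_finite_and_numSp_le k).1,
    LinHom.colorHomTypes_finite⟩, ⟨5 / 2, ?_⟩, ?_, ?_, LinHom.tendsto_numSp_div_numColored⟩
  · exact (LinHom.spHomTypes_finite_and_numSp_le _).1.subset
      (LinHom.cHomTypes_subset_spHomTypes n m)
  · rintro n m _ rfl
    have h : (LinHom.numC n m : ℝ) ≤ LinHom.numSp (n + m + 1) := by
      exact_mod_cast LinHom.numC_le_numSp n m
    exact h.trans (LinHom.numSp_le _)
  · intro ε hε
    obtain ⟨K, hK⟩ := eventually_atTop.1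
      (LinHom.tendsto_numSp_div_numColored.eventually (gt_mem_nhds hε))
    refine ⟨K, ?_⟩
    rintro n m _ rfl hk
    refine lt_of_le_of_lt ?_ (hK _ hk)
    have h : (LinHom.numC n m : ℝ) ≤ LinHom.numSp (n + m + 1) := by
      exact_mod_cast LinHom.numC_le_numSp n m
    gcongr
  · refine Asymptotics.IsBigO.of_bound (5 / 2) (Eventually.of_forall fun k => ?_)
    rw [Real.norm_of_nonneg (by positivity), Real.norm_of_nonneg (by positivity)]
    exact LinHom.numSp_le k
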